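/- Let $R$ be a commutative artinian ring and let $A$ be a connected Nakayama artin $R$-algebra: $A$ is a nonzero ring that is finitely generated as an $R$-module, its only central idempotents are $0$ and $1$, and every finitely generated indecomposable projective or injective left $A$-module is uniserial. Let $n$ be the number of isomorphism classes of simple left $A$-modules. For a simple module $S$ let $P(S)$ be its projective cover and put $\gamma(S)=\tilde\tau(\operatorname{soc}P(S))$, where, for a simple module $T$, $\tilde\tau(T)=\tau(T)=D\operatorname{Tr}T$ is the Auslander–Reiten translate if $T$ is not projective, and $\tilde\tau(T)$ is the unique (up to isomorphism) simple injective $A$-module if $T$ is projective. The resolution quiver $R(A)$ has as vertices the isomorphism classes of simple $A$-modules, with exactly one arrow $S\to\gamma(S)$ for each vertex $S$. The weight of an oriented cycle with distinct vertices $S_1,\dots,S_m$ ($m\ge 1$) in $R(A)$ is $\frac1n\sum_{k=1}^m c_k$, where $c_k$ is the composition length of $P(S_k)$. It is known that $R(A)$ has a cycle and that all its cycles have the same weight; this common value is called the weight of $A$. Then $A$ has finite global dimension if and only if the quiver $R(A)$ is connected and the weight of $A$ is $1$ (that is, $R(A)$ has a cycle and every cycle has weight $1$). -/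

import Mathlib

universe v u

namespace NakayamaAlgebra

section Modules

/-- A module is uniserial if its submodules are totally ordered by inclusion. -/
def IsUniserial (A M : Type*) [Ring A] [AddCommGroup M] [Module A M] : Prop :=
  ∀ N N' : Submodule A M, N ≤ N' ∨ N' ≤ N

/-- A module is indecomposable if it is nonzero and is not the direct sum of two nonzero
submodules. -/
def IsIndecomposable (A M : Type*) [Ring A] [AddCommGroup M] [Module A M] : Prop :=
  Nontrivial M ∧ ∀ N N' : Submodule A M, IsCompl N N' → N = ⊥ ∨ N' = ⊥

/-- The socle of a module: the sum of its simple submodules. -/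
def socle (A M : Type*) [Ring A] [AddCommGroup M] [Module A M] : Submodule A M :=
  sSup {N : Submodule A M | IsSimpleModule A N}

/-- A projective cover of `M`: a surjection from a projective module onto `M` whose kernel is
superfluous. -/
structure IsProjectiveCover {A P M : Type*} [Ring A] [AddCommGroup P] [Module A P]
    [AddCommGroup M] [Module A M] (f : P →ₗ[A] M) : Prop where
  projective : Module.Projective A P
  surjective : Function.Surjective f
  superfluous : ∀ N : Submodule A P, N ⊔ LinearMap.ker f = ⊤ → N = ⊤

/-- An injective envelope of `M`: an embedding of `M` into an injective module whose image is
essential. -/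
structure IsInjectiveEnvelope {A : Type*} {M : Type*} {J : Type v} [Ring A] [AddCommGroup M]
    [Module A M] [AddCommGroup J] [Module A J] (i : M →ₗ[A] J) : Prop where
  injectiveModule : Module.Injective A J
  injective : Function.Injective i
  essential : ∀ N : Submodule A J, N ⊓ LinearMap.range i = ⊥ → N = ⊥

/-- Over a left artinian ring every simple module has a projective cover (which can be realised
as a left ideal). -/
theorem exists_projectiveCover (A S : Type*) [Ring A] [IsArtinianRing A] [AddCommGroup S]
    [Module A S] [IsSimpleModule A S] :
    ∃ (P : Submodule A A) (f : P →ₗ[A] S), IsProjectiveCover f := by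
  have := IsSimpleModule.nontrivial A S
  obtain ⟨x, hx⟩ := exists_ne (0 : S)
  let φ : A →ₗ[A] S := LinearMap.toSpanSingleton A S x
  have hφ : Function.Surjective φ := IsSimpleModule.toSpanSingleton_surjective A hx
  obtain ⟨L, hL, hmin⟩ := WellFounded.has_min
    (wellFounded_lt : WellFounded ((· < ·) : Submodule A A → Submodule A A → Prop))
    {L | L.map φ = ⊤} ⟨⊤, by simpa using LinearMap.range_eq_top.2 hφ⟩
  have hmin' : ∀ N : Submodule A L, (N.map L.subtype).map φ = ⊤ → N = ⊤ := by
    intro N hN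
    have h1 : N.map L.subtype ≤ L := Submodule.map_subtype_le L N
    have h2 : N.map L.subtype = L := by
      by_contra hne
      exact hmin _ hN (lt_of_le_of_ne h1 hne)
    apply Submodule.map_injective_of_injective L.injective_subtype
    rw [h2, Submodule.map_top, Submodule.range_subtype]
  have hsurj : Function.Surjective (φ ∘ₗ L.subtype) := by
    intro s
    have : s ∈ L.map φ := by
      have hL' : L.map φ = ⊤ := hL
      rw [hL']; trivial
    obtain ⟨a, ha, rfl⟩ := this
    exact ⟨⟨a, ha⟩, rfl⟩
  obtain ⟨f, hf⟩ := Module.projective_lifting_property (φ ∘ₗ L.subtype) φ hsurj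
  have hg : φ ∘ₗ L.subtype ∘ₗ (f ∘ₗ L.subtype) = φ ∘ₗ L.subtype := by
    rw [← LinearMap.comp_assoc, ← LinearMap.comp_assoc, hf]
  have hgs : Function.Surjective (f ∘ₗ L.subtype) := by
    rw [← LinearMap.range_eq_top]
    apply hmin'
    rw [← LinearMap.range_comp, ← LinearMap.range_comp, hg]
    exact LinearMap.range_eq_top.2 hsurj
  have hgi : Function.Injective (f ∘ₗ L.subtype) :=
    IsNoetherian.injective_of_surjective_endomorphism _ hgs
  let e := LinearEquiv.ofBijective (f ∘ₗ L.subtype) ⟨hgi, hgs⟩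
  refine ⟨L, φ ∘ₗ L.subtype, ⟨?_, hsurj, ?_⟩⟩
  · refine Module.Projective.of_split L.subtype (e.symm.toLinearMap ∘ₗ f) ?_
    ext y
    exact congrArg Subtype.val (e.symm_apply_apply y)
  · intro N hN
    apply hmin'
    have := congrArg (Submodule.map (φ ∘ₗ L.subtype)) hN
    rw [Submodule.map_sup, Submodule.map_top, LinearMap.range_eq_top.2 hsurj] at this
    have hker : Submodule.map (φ ∘ₗ L.subtype) (LinearMap.ker (φ ∘ₗ L.subtype)) = ⊥ :=
      LinearMap.le_ker_iff_map.1 le_rfl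
    rw [hker, sup_bot_eq, Submodule.map_comp] at this
    exact this

end Modules

section Algebras

/-- A ring is connected if it is nonzero and its only central idempotents are `0` and `1`, i.e. it
is not a product of two nonzero rings. -/
def IsConnectedRing (A : Type*) [Ring A] : Prop :=
  Nontrivial A ∧ ∀ e ∈ Subring.center A, IsIdempotentElem e → e = 0 ∨ e = 1

/-- The Nakayama condition: all finitely generated indecomposable projective modules and all
finitely generated indecomposable injective modules are uniserial. -/
structure IsNakayama (A : Type u) [Ring A] : Prop where
  projective_uniserial : ∀ (M : Type u) [AddCommGroup M] [Module A M], Module.Finite A M →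
    Module.Projective A M → IsIndecomposable A M → IsUniserial A M
  injective_uniserial : ∀ (M : Type u) [AddCommGroup M] [Module A M], Module.Finite A M →
    Module.Injective A M → IsIndecomposable A M → IsUniserial A M

/-- Finite global dimension: the projective dimensions of all left modules have a common finite
bound. -/
def HasFiniteGlobalDimension (A : Type u) [Ring A] : Prop :=
  ∃ d : ℕ, ∀ M : ModuleCat.{u} A, CategoryTheory.HasProjectiveDimensionLE M d

end Algebras

section Translate

variable {A : Type u} [Ring A]

/-- The map of right modules `Hom_A(P₀, A) → Hom_A(P₁, A)` induced by `d : P₁ → P₀`.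
Right `A`-modules are modules over `Aᵐᵒᵖ`. -/
def dualMap {P₀ P₁ : Type*} [AddCommGroup P₀] [Module A P₀] [AddCommGroup P₁] [Module A P₁]
    (d : P₁ →ₗ[A] P₀) : (P₀ →ₗ[A] A) →ₗ[Aᵐᵒᵖ] (P₁ →ₗ[A] A) where
  toFun g := g ∘ₗ d
  map_add' _ _ := rfl
  map_smul' _ _ := rfl

/-- The cokernel of `Hom_A(P₀, A) → Hom_A(P₁, A)`, a right `A`-module. When `P₁ → P₀ → M → 0` is a
minimal projective presentation, this is the transpose `Tr M`. -/
abbrev Transpose {P₀ P₁ : Type*} [AddCommGroup P₀] [Module A P₀] [AddCommGroup P₁] [Module A P₁]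
    (d : P₁ →ₗ[A] P₀) : Type _ :=
  (P₁ →ₗ[A] A) ⧸ LinearMap.range (dualMap d)

/-- `Hom_R(X, J)` for a right `A`-module `X`. -/
def ArtinDual (R : Type v) [CommRing R] (X J : Type*) [AddCommGroup X] [Module R X]
    [AddCommGroup J] [Module R J] : Type _ := X →ₗ[R] J

instance (R : Type v) [CommRing R] (X J : Type*) [AddCommGroup X] [Module R X]
    [AddCommGroup J] [Module R J] : AddCommGroup (ArtinDual R X J) :=
  inferInstanceAs (AddCommGroup (X →ₗ[R] J))

/-- For a right `A`-module `X` and `g ∈ Hom_R(X, J)`, the map `x ↦ g (x a)`. -/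
def ArtinDual.act {R : Type v} [CommRing R] [Algebra R A] {X J : Type*} [AddCommGroup X]
    [Module R X] [Module Aᵐᵒᵖ X] [IsScalarTower R Aᵐᵒᵖ X] [AddCommGroup J] [Module R J]
    (a : A) (g : X →ₗ[R] J) : X →ₗ[R] J where
  toFun x := g (MulOpposite.op a • x)
  map_add' x y := by rw [smul_add, map_add]
  map_smul' r x := by rw [smul_algebra_smul_comm, map_smul, RingHom.id_apply]

/-- The left `A`-module structure on `Hom_R(X, J)` for a right `A`-module `X`, given by
`(a • g) x = g (x a)`. -/
instance (R : Type v) [CommRing R] [Algebra R A] (X J : Type*) [AddCommGroup X] [Module R X]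
    [Module Aᵐᵒᵖ X] [IsScalarTower R Aᵐᵒᵖ X] [AddCommGroup J] [Module R J] :
    Module A (ArtinDual R X J) where
  smul a g := ArtinDual.act a g
  one_smul g := LinearMap.ext fun x => congrArg (fun y => (show X →ₗ[R] J from g) y) <| by
    rw [MulOpposite.op_one, one_smul]
  mul_smul a b g := LinearMap.ext fun x => congrArg (fun y => (show X →ₗ[R] J from g) y) <| by
    rw [MulOpposite.op_mul, mul_smul]
  smul_zero a := LinearMap.ext fun x => rfl
  smul_add a g h := LinearMap.ext fun x => rfl
  add_smul a b g := LinearMap.ext fun x => by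
    change (show X →ₗ[R] J from g) (MulOpposite.op (a + b) • x) =
      (show X →ₗ[R] J from g) (MulOpposite.op a • x) +
        (show X →ₗ[R] J from g) (MulOpposite.op b • x)
    rw [MulOpposite.op_add, add_smul, map_add]
  zero_smul g := LinearMap.ext fun x => by
    change (show X →ₗ[R] J from g) (MulOpposite.op 0 • x) = 0
    rw [MulOpposite.op_zero, zero_smul, map_zero]

/-- `P₁ → P₀ → M → 0`, given by `d` and `π`, is a minimal projective presentation: `π` is a
projective cover of `M` and `d` is a projective cover of the kernel of `π`. -/
def IsMinimalPresentation {P₀ P₁ M : Type*} [AddCommGroup P₀] [Module A P₀] [AddCommGroup P₁]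
    [Module A P₁] [AddCommGroup M] [Module A M] (d : P₁ →ₗ[A] P₀) (π : P₀ →ₗ[A] M) : Prop :=
  IsProjectiveCover π ∧
    ∃ h : ∀ x, d x ∈ LinearMap.ker π, IsProjectiveCover (d.codRestrict (LinearMap.ker π) h)

/-- `N` is isomorphic to the Auslander-Reiten translate `τ M = D Tr M`, where `Tr M` is the
transpose of `M` formed with a minimal projective presentation and `D = Hom_R(-, J)` is the usual
duality, `J` being an injective envelope of `R / rad R`. -/
def IsARTranslate (A : Type u) [Ring A] (R : Type v) [CommRing R] [Algebra R A] (M N : Type u)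
    [AddCommGroup M] [Module A M] [AddCommGroup N] [Module A N] : Prop :=
  ∃ (P₀ P₁ : ModuleCat.{u} A) (d : P₁ →ₗ[A] P₀) (π : P₀ →ₗ[A] M)
    (J : ModuleCat.{v} R) (i : (R ⧸ Ring.jacobson R) →ₗ[R] J),
    IsMinimalPresentation d π ∧ IsInjectiveEnvelope i ∧
      Nonempty (N ≃ₗ[A] ArtinDual R (Transpose d) J)

/-- `N ≅ τ̃ M` for simple modules `M` and `N`: if `M` is not projective then `N ≅ τ M`, and if `M`
is projective then `N` is the simple injective module. -/
def IsTauTilde (A : Type u) [Ring A] (R : Type v) [CommRing R] [Algebra R A] (M N : Type u)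
    [AddCommGroup M] [Module A M] [AddCommGroup N] [Module A N] : Prop :=
  (¬ Module.Projective A M ∧ IsARTranslate A R M N) ∨
    (Module.Projective A M ∧ IsSimpleModule A N ∧ Module.Injective A N)

end Translate

section ResolutionQuiver

/-- Isomorphism of simple left `A`-modules. -/
instance simpleSetoid (A : Type u) [Ring A] :
    Setoid {S : ModuleCat.{u} A // IsSimpleModule A S} where
  r S T := Nonempty (S.1 ≃ₗ[A] T.1)
  iseqv := ⟨fun _ => ⟨LinearEquiv.refl _ _⟩, fun ⟨e⟩ => ⟨e.symm⟩, fun ⟨e⟩ ⟨f⟩ => ⟨e.trans f⟩⟩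

variable (R : Type v) (A : Type u) [CommRing R] [Ring A] [Algebra R A]

/-- The vertex set of the resolution quiver of the `R`-algebra `A`: the isomorphism classes of
simple left `A`-modules. -/
def ResolutionQuiver (_R : Type v) (A : Type u) [Ring A] : Type (u + 1) :=
  Quotient (simpleSetoid A)

variable {R A}

/-- A simple module in the given isomorphism class. -/
noncomputable def ResolutionQuiver.simple (s : ResolutionQuiver R A) : ModuleCat.{u} A :=
  (Quotient.out (s := simpleSetoid A) s).1

instance (s : ResolutionQuiver R A) : IsSimpleModule A s.simple :=
  (Quotient.out (s := simpleSetoid A) s).2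

variable [IsArtinianRing R] [Module.Finite R A]

/-- The projective cover `P(S)` of the simple module `S` (unique up to isomorphism). -/
noncomputable def ResolutionQuiver.proj (s : ResolutionQuiver R A) : Submodule A A :=
  haveI : IsArtinianRing A := IsArtinianRing.of_finite R A
  (exists_projectiveCover A s.simple).choose

/-- `proj s` is indeed a projective cover of `simple s`. -/
theorem ResolutionQuiver.proj_spec (s : ResolutionQuiver R A) :
    ∃ f : s.proj →ₗ[A] s.simple, IsProjectiveCover f :=
  haveI : IsArtinianRing A := IsArtinianRing.of_finite R A
  (exists_projectiveCover A s.simple).choose_spec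

/-- There is one arrow from `S` to `T` if `T ≅ γ(S) = τ̃ soc P(S)`, and none otherwise. -/
instance : Quiver (ResolutionQuiver R A) where
  Hom s t := PLift (IsTauTilde A R (socle A s.proj) t.simple)

/-- A quiver is connected if it has exactly one connected component. -/
def IsConnectedQuiver (V : Type*) [Quiver V] : Prop :=
  Nonempty V ∧ Subsingleton (Quiver.WeaklyConnectedComponent V)

/-- An oriented cycle of a quiver without multiple arrows: a nonempty cyclic sequence of distinct
vertices, each with an arrow to the next one. A loop is a cycle with one vertex. -/
def IsQuiverCycle {V : Type*} [Quiver V] (C : Cycle V) : Prop :=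
  C ≠ Cycle.nil ∧ C.Nodup ∧ C.Chain fun s t => Nonempty (s ⟶ t)

/-- The weight of a cycle: the sum of the composition lengths of the projective covers of the
simple modules on it, divided by the number of isomorphism classes of simple modules. -/
noncomputable def cycleWeight (C : Cycle (ResolutionQuiver R A)) : ℚ :=
  (C.toMultiset.map fun s => ((Module.length A s.proj).toNat : ℚ) /
    (Nat.card (ResolutionQuiver R A) : ℚ)).sum

variable (R A) in
/-- The weight of the algebra is `w`: the resolution quiver has a cycle, and every cycle in it has
weight `w`. -/
def HasWeight (w : ℚ) : Prop :=
  (∃ C : Cycle (ResolutionQuiver R A), IsQuiverCycle C) ∧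
    ∀ C : Cycle (ResolutionQuiver R A), IsQuiverCycle C → cycleWeight C = w

end ResolutionQuiver

end NakayamaAlgebra

/-! For a nonprojective simple S the module rad P(S) is uniserial, and its top determines S. Hence
there is a permutation σ of the simples such that P(σ S) maps onto rad P(S) for every S; at a simple
projective the condition is empty (`exists_isSuccessor`). Injectivity rests on the uniseriality of
the right modules Hom(P, A), obtained by Matlis duality from the condition on injectives.
Connectedness of A makes σ a single n-cycle (`IsSuccessor.sameCycle`). So, from a base vertex s, the
simples are numbered by x ↦ σ^x s, with period n.

A quotient of length y - x of P(σ^x s) is encoded by the interval from x to y. Put f(x) = x + length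
P(σ^x s). The syzygy of (x, y) is (y, f x), so the second syzygy is (f x, f y), and the module is
projective exactly when x = y or y = f x. Thus it has projective dimension at most 2k if and only if
f^k x = f^k y or f^k y = f^(k+1) x (`IsSuccessor.projDimLE_two_mul_iff`). Finite global dimension
means that some k works for each simple (x, x + 1).

On simples τ̃ is σ (`IsSuccessor.isTauTilde_iff`), and soc P(S) is σ^(len S - 1) S, so γ(S) = σ^(len
S) S: the function f is a lift of γ to the natural numbers, and the weight of a cycle of γ is its
winding number. It remains to prove a statement about monotone lifts of self-maps of a cyclically
ordered set, `forall_iterate_meet_iff`. -/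

namespace NakayamaAlgebra

/-! ### Monotone lifts of self-maps of a finite cycle. -/

section Combinatorics

/-- Two points have eventually the same orbit. -/
def EventuallyMeet {V : Type*} (γ : V → V) (s t : V) : Prop := ∃ a b : ℕ, γ^[a] s = γ^[b] t

theorem EventuallyMeet.refl {V : Type*} (γ : V → V) (s : V) : EventuallyMeet γ s s := ⟨0, 0, rfl⟩

theorem EventuallyMeet.symm {V : Type*} {γ : V → V} {s t : V} (h : EventuallyMeet γ s t) :
    EventuallyMeet γ t s :=
  let ⟨a, b, h⟩ := h
  ⟨b, a, h.symm⟩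

theorem EventuallyMeet.trans {V : Type*} {γ : V → V} {s t u : V} (h : EventuallyMeet γ s t)
    (h' : EventuallyMeet γ t u) : EventuallyMeet γ s u := by
  obtain ⟨a, b, h⟩ := h
  obtain ⟨c, d, h'⟩ := h'
  refine ⟨c + a, b + d, ?_⟩
  rw [Function.iterate_add_apply, h, ← Function.iterate_add_apply, add_comm c b,
    Function.iterate_add_apply, h', ← Function.iterate_add_apply]

theorem nonempty_periodicPts {V : Type*} [Finite V] [Nonempty V] (γ : V → V) :
    (Function.periodicPts γ).Nonempty := by
  obtain ⟨s⟩ := ‹Nonempty V›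
  obtain ⟨i, j, hij, h⟩ := Finite.exists_ne_map_eq_of_infinite fun k : ℕ => γ^[k] s
  wlog hlt : i < j generalizing i j
  · exact this j i hij.symm h.symm (by omega)
  refine ⟨γ^[i] s, j - i, by omega, ?_⟩
  unfold Function.IsPeriodicPt Function.IsFixedPt
  rw [← Function.iterate_add_apply, Nat.sub_add_cancel hlt.le]
  exact h.symm

variable {n : ℕ} {f : ℕ → ℕ}

theorem iterate_add_period (hf : ∀ x, f (x + n) = f x + n) (k x q : ℕ) :
    f^[k] (x + q * n) = f^[k] x + q * n := by
  induction q with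
  | zero => simp
  | succ q ih =>
    have h1 : ∀ y, f^[k] (y + n) = f^[k] y + n := by
      intro y
      exact (Function.Semiconj.iterate_right (f := (· + n)) (fun x => (hf x).symm) k y).symm
    rw [Nat.succ_mul, ← add_assoc, h1, ih, add_assoc]

theorem iterate_mul_period {m z w : ℕ} (hf : ∀ x, f (x + n) = f x + n)
    (hz : f^[m] z = z + w * n) (j : ℕ) : f^[j * m] z = z + j * w * n := by
  induction j with
  | zero => simp
  | succ j ih =>
    rw [Nat.succ_mul, Function.iterate_add_apply, hz, iterate_add_period hf, ih]
    ring

theorem strictMono_iterate_apply (hlt : ∀ x, x < f x) (z : ℕ) : StrictMono fun j => f^[j] z :=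
  strictMono_nat_of_lt_succ fun j => by
    rw [Function.iterate_succ_apply']
    exact hlt _

/-- This links weight and winding: over one period of γ the sum of the c's is the distance travelled
by the lift. -/
theorem iterate_eq_add_sum {V : Type*} {v : ℕ → V} {γ : V → V} {c : V → ℕ}
    (hfc : ∀ x, f x = x + c (v x)) (hγ : ∀ x, γ (v x) = v (f x)) (m x : ℕ) :
    v (f^[m] x) = γ^[m] (v x) ∧ f^[m] x = x + ∑ i ∈ Finset.range m, c (γ^[i] (v x)) := by
  induction m with
  | zero => simp
  | succ m ih =>
    rw [Function.iterate_succ_apply', Function.iterate_succ_apply', ← ih.1, hγ]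
    refine ⟨rfl, ?_⟩
    rw [hfc, ih.1, Finset.sum_range_succ, ← add_assoc, ← ih.2]

/-- The combinatorial heart: for a monotone lift `f` of a self-map `γ` of a cyclically ordered
finite set, neighbouring points get identified up to one application of `f` if and only if `γ`
is connected and its cycles wind around exactly once. -/
theorem forall_iterate_meet_iff {V : Type*} {v : ℕ → V} {γ : V → V} {c : V → ℕ} (hn : 0 < n)
    (hv : Function.Surjective v) (hvn : ∀ x y, v x = v y ↔ x ≡ y [MOD n])
    (hfc : ∀ x, f x = x + c (v x)) (hγ : ∀ x, γ (v x) = v (f x)) (hlt : ∀ x, x < f x)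
    (hmono : Monotone f) :
    (∀ x, ∃ k, f^[k] x = f^[k] (x + 1) ∨ f^[k] (x + 1) = f^[k + 1] x) ↔
      (∀ s t, EventuallyMeet γ s t) ∧
        ∀ s ∈ Function.periodicPts γ,
          ∑ i ∈ Finset.range (Function.minimalPeriod γ s), c (γ^[i] s) = n := by
  have hf : ∀ x, f (x + n) = f x + n := by
    intro x
    rw [hfc, hfc, (hvn (x + n) x).2 (by simp [Nat.ModEq])]
    ring
  have hit := iterate_eq_add_sum (f := f) hfc hγ
  constructor
  · intro h
    have hN : ∀ x, EventuallyMeet f x (x + 1) := by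
      intro x
      obtain ⟨k, hk | hk⟩ := h x
      exacts [⟨k, k, hk⟩, ⟨k + 1, k, hk.symm⟩]
    -- Chaining neighbours gives all pairs; the case of x and x + n will control the winding number.
    have hN' : ∀ x y, EventuallyMeet f x (x + y) := by
      intro x y
      induction y with
      | zero => exact EventuallyMeet.refl _ _
      | succ y ih => exact ih.trans (hN _)
    have hV : ∀ x y, EventuallyMeet γ (v x) (v (x + y)) := by
      intro x y
      obtain ⟨a, b, hab⟩ := hN' x y
      refine ⟨a, b, ?_⟩
      rw [← (hit a x).1, ← (hit b (x + y)).1, hab]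
    refine ⟨fun s t => ?_, fun s hs => ?_⟩
    · obtain ⟨x, rfl⟩ := hv s
      obtain ⟨y, rfl⟩ := hv t
      have h1 := hV 0 x
      have h2 := hV 0 y
      rw [zero_add] at h1 h2
      exact h1.symm.trans h2
    · obtain ⟨x, rfl⟩ := hv s
      set m := Function.minimalPeriod γ (v x) with hm
      have hmpos : 0 < m := Function.minimalPeriod_pos_of_mem_periodicPts hs
      set W := ∑ i ∈ Finset.range m, c (γ^[i] (v x)) with hW
      have hxW : f^[m] x = x + W := (hit m x).2
      have hdvd : n ∣ W := by
        have h1 : v (x + W) = v x := by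
          rw [← hxW, (hit m x).1, hm, Function.iterate_minimalPeriod]
        have h2 := (Nat.modEq_iff_dvd' (Nat.le_add_right x W)).1 ((hvn _ _).1 h1.symm)
        simpa using h2
      obtain ⟨w, hw⟩ := hdvd
      rw [mul_comm] at hw
      have hz : f^[m] x = x + w * n := by rw [hxW, hw]
      -- Here f^a x = f^b x + n. Applying f another b(m - 1) times gives x + (bw + 1)n, since f^(bm)
      -- x = x + bwn. So b(m - 1) + a is a period l·m of `v x`, whence lw = bw + 1 and w divides 1.
      obtain ⟨a, b, hab⟩ := hN' x n
      have hab' : f^[a] x = f^[b] x + n := by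
        rw [hab]
        simpa using iterate_add_period hf b x 1
      have hq : f^[b * (m - 1) + a] x = x + (b * w + 1) * n := by
        have h1 := iterate_add_period hf (b * (m - 1)) (f^[b] x) 1
        rw [one_mul] at h1
        rw [Function.iterate_add_apply, hab', h1, ← Function.iterate_add_apply]
        have h2 : b * (m - 1) + b = b * m := by
          obtain ⟨m', hm'⟩ : ∃ m', m = m' + 1 := ⟨m - 1, by omega⟩
          rw [hm']
          simp
          ring
        rw [h2, iterate_mul_period hf hz]
        ring
      have hper : Function.IsPeriodicPt γ (b * (m - 1) + a) (v x) := by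
        unfold Function.IsPeriodicPt Function.IsFixedPt
        rw [← (hit _ x).1, hq, hvn]
        simp [Nat.ModEq]
      obtain ⟨l, hl⟩ := hper.minimalPeriod_dvd
      rw [hl, ← hm, mul_comm, iterate_mul_period hf hz] at hq
      have h3 : l * w = b * w + 1 :=
        Nat.eq_of_mul_eq_mul_right hn (Nat.add_left_cancel hq)
      have h4 : w ∣ 1 := (Nat.dvd_add_right (Dvd.intro_left b rfl)).1 (h3 ▸ Dvd.intro_left l rfl)
      rw [hw, Nat.dvd_one.1 h4, one_mul]
  · rintro ⟨hconn, hwt⟩ x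
    obtain ⟨s, hs⟩ : ∃ s, s ∈ Function.periodicPts γ := by
      have : Finite V := by
        refine Finite.of_surjective (fun i : Fin n => v i) fun s => ?_
        obtain ⟨y, rfl⟩ := hv s
        exact ⟨⟨y % n, Nat.mod_lt _ hn⟩, (hvn _ _).2 (Nat.mod_modEq y n)⟩
      have : Nonempty V := ⟨v 0⟩
      exact nonempty_periodicPts γ
    obtain ⟨z, rfl⟩ := hv s
    have hzm : f^[Function.minimalPeriod γ (v z)] z = z + 1 * n := by
      rw [(hit _ z).2, hwt _ hs, one_mul]
    set m := Function.minimalPeriod γ (v z)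
    have hz := iterate_mul_period hf hzm
    -- Meeting γ-orbits give iterates of x and z that differ by a multiple of n. As the winding
    -- number is 1, adding n on the orbit of z is the same as applying f^m, so the f-orbits
    -- themselves meet.
    have key : ∀ x, ∃ k j, f^[k] x = f^[j] z := by
      intro x
      obtain ⟨a, b, hab⟩ := hconn (v x) (v z)
      rw [← (hit a x).1, ← (hit b z).1, hvn] at hab
      obtain ⟨p, q, hpq⟩ : ∃ p q, f^[a] x + p * n = f^[b] z + q * n := by
        rcases le_total (f^[a] x) (f^[b] z) with hle | hle
        · obtain ⟨p, hp⟩ := (Nat.modEq_iff_dvd' hle).1 hab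
          exact ⟨p, 0, by rw [mul_comm]; omega⟩
        · obtain ⟨p, hp⟩ := (Nat.modEq_iff_dvd' hle).1 hab.symm
          exact ⟨0, p, by rw [mul_comm p]; omega⟩
      refine ⟨p * m + a, b + q * m, ?_⟩
      have h1 := iterate_add_period hf (p * m) (f^[a] x) p
      rw [hpq, iterate_add_period hf, ← Function.iterate_add_apply, add_comm (p * m) b,
        Function.iterate_add_apply, hz, mul_one, iterate_add_period hf] at h1
      rw [Function.iterate_add_apply, Function.iterate_add_apply f b, hz, mul_one,
        iterate_add_period hf]
      omega
    obtain ⟨a, i, hi⟩ := key x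
    obtain ⟨b, j, hj⟩ := key (x + 1)
    have h1 : f^[b + a] x = f^[b + i] z := by
      rw [Function.iterate_add_apply, hi, Function.iterate_add_apply]
    have h2 : f^[b + a] (x + 1) = f^[a + j] z := by
      rw [add_comm, Function.iterate_add_apply, hj, Function.iterate_add_apply]
    have h3 : f^[b + a + 1] x = f^[b + i + 1] z := by
      rw [Function.iterate_succ_apply', h1, ← Function.iterate_succ_apply' f]
    -- Squeeze: from x ≤ x + 1 ≤ f x, the iterate of x + 1 lies between two consecutive terms of the
    -- strictly increasing orbit of z, and it is itself on that orbit, so it equals one of them.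
    have hle1 := hmono.iterate (b + a) (Nat.le_succ x)
    have hle2 := hmono.iterate (b + a) (hlt x)
    rw [← Function.iterate_succ_apply] at hle2
    simp only [Nat.succ_eq_add_one] at hle1 hle2
    rw [h3, h2] at hle2
    rw [h1, h2] at hle1
    have hs := strictMono_iterate_apply hlt z
    have hle1' := hs.le_iff_le.1 hle1
    have hle2' := hs.le_iff_le.1 hle2
    refine ⟨b + a, ?_⟩
    rw [h1, h2, h3]
    rcases Nat.eq_or_lt_of_le hle1' with h | h
    · left; rw [h]
    · right
      have : a + j = b + i + 1 := by omega
      rw [this]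

end Combinatorics

/-! ### Existence of injective envelopes. -/

section InjectiveEnvelope

/-- The elementwise form of: `N` is an essential submodule of `K`. -/
def IsEssentialIn {A E : Type*} [Ring A] [AddCommGroup E] [Module A E] (N K : Submodule A E) :
    Prop :=
  ∀ x ∈ K, x ≠ 0 → ∃ a : A, a • x ∈ N ∧ a • x ≠ 0

theorem exists_maximal_essential {A E : Type*} [Ring A] [AddCommGroup E] [Module A E]
    (N : Submodule A E) :
    ∃ K, N ≤ K ∧ Maximal (fun K => IsEssentialIn N K) K := by
  have hN : IsEssentialIn N N := fun x hx hx0 => ⟨1, by simpa using hx, by simpa using hx0⟩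
  obtain ⟨K, h1, h2⟩ := zorn_le_nonempty₀ {K | IsEssentialIn N K} (fun c hc hchain y hy => by
    refine ⟨sSup c, fun x hx hx0 => ?_, fun z hz => le_sSup hz⟩
    obtain ⟨K, hK, hxK⟩ := (Submodule.mem_sSup_of_directed ⟨y, hy⟩ hchain.directedOn).1 hx
    exact hc hK x hxK hx0) N hN
  exact ⟨K, h1, h2⟩

theorem exists_maximal_disjoint {A E : Type*} [Ring A] [AddCommGroup E] [Module A E]
    (K : Submodule A E) : ∃ L, Maximal (fun L => L ⊓ K = ⊥) L := by
  obtain ⟨L, -, h2⟩ := zorn_le_nonempty₀ {L | L ⊓ K = ⊥} (fun c hc hchain y hy => by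
    refine ⟨sSup c, ?_, fun z hz => le_sSup hz⟩
    rw [Set.mem_ofPred_eq, Submodule.eq_bot_iff]
    rintro x ⟨hx, hxK⟩
    obtain ⟨L, hL, hxL⟩ := (Submodule.mem_sSup_of_directed ⟨y, hy⟩ hchain.directedOn).1 hx
    have : x ∈ L ⊓ K := ⟨hxL, hxK⟩
    rw [hc hL] at this
    exact this) (⊥ : Submodule A E) (by simp)
  exact ⟨L, h2⟩

/-- A maximal essential extension inside an injective module is injective. -/
theorem baer_of_maximal_essential {A E : Type*} [Ring A] [AddCommGroup E] [Module A E]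
    (hE : Module.Baer A E) {N K : Submodule A E}
    (hK : Maximal (fun K => IsEssentialIn N K) K) : Module.Baer A K := by
  obtain ⟨L, hL, hLmax⟩ := exists_maximal_disjoint K
  -- K embeds essentially in E/L. The inclusion of K extends to φ : E/L → E, whose range is again
  -- essential over N and contains K, so it equals K by maximality. Hence K is a retract of E.
  let ι : K →ₗ[A] E ⧸ L := L.mkQ ∘ₗ K.subtype
  have hι : Function.Injective ι := by
    rw [← LinearMap.ker_eq_bot, Submodule.eq_bot_iff]
    intro x hx
    have h1 : (x : E) ∈ L ⊓ K := ⟨by simpa [ι] using hx, x.2⟩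
    rw [hL] at h1
    exact Subtype.ext h1
  obtain ⟨φ, hφ⟩ := hE.extension_property ι hι K.subtype
  have hφK : ∀ x : K, φ (L.mkQ x) = x := fun x => LinearMap.congr_fun hφ x
  -- every nonzero submodule of the quotient meets the image of `K`
  have hmeet : ∀ x : E, x ∉ L → ∃ a : A, ∃ l ∈ L, ∃ k ∈ K, a • x = l + k ∧ k ≠ 0 := by
    intro x hx
    have h1 : ¬ (L ⊔ Submodule.span A {x}) ⊓ K = ⊥ := by
      intro h
      have h2 := hLmax (y := L ⊔ Submodule.span A {x}) h le_sup_left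
      exact hx (h2 (Submodule.mem_sup_right (Submodule.mem_span_singleton_self x)))
    obtain ⟨k, ⟨hk1, hk2⟩, hk0⟩ := Submodule.exists_mem_ne_zero_of_ne_bot h1
    obtain ⟨l, hl, y, hy, hly⟩ := Submodule.mem_sup.1 hk1
    obtain ⟨a, rfl⟩ := Submodule.mem_span_singleton.1 hy
    exact ⟨a, -l, L.neg_mem hl, k, hk2, by rw [← hly]; abel, hk0⟩
  have hφinj : ∀ x : E, φ (L.mkQ x) = 0 → x ∈ L := by
    intro x hx
    by_contra hxL
    obtain ⟨a, l, hl, k, hk, hak, hk0⟩ := hmeet x hxL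
    apply hk0
    have h1 : L.mkQ l = 0 := by simpa using hl
    have h2 : φ (L.mkQ (a • x)) = k := by
      rw [hak, map_add, h1, zero_add, hφK ⟨k, hk⟩]
    rw [← h2, map_smul, map_smul, hx, smul_zero]
  have hrange : ∀ q, φ q ∈ K := by
    have h1 : IsEssentialIn N (LinearMap.range φ) := by
      rintro _ ⟨q, rfl⟩ hq
      obtain ⟨x, rfl⟩ := L.mkQ_surjective q
      have hxL : x ∉ L := fun h => hq (by rw [show L.mkQ x = 0 by simpa using h, map_zero])
      obtain ⟨a, l, hl, k, hk, hak, hk0⟩ := hmeet x hxL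
      obtain ⟨b, hb, hb0⟩ := hK.prop k hk hk0
      have h1 : L.mkQ l = 0 := by simpa using hl
      have h2 : φ (L.mkQ (a • x)) = k := by
        rw [hak, map_add, h1, zero_add, hφK ⟨k, hk⟩]
      rw [map_smul, map_smul] at h2
      refine ⟨b * a, ?_, ?_⟩ <;> rw [mul_smul, h2] <;> assumption
    have h2 : K ≤ LinearMap.range φ := fun x hx => ⟨_, hφK ⟨x, hx⟩⟩
    intro q
    exact hK.2 h1 h2 ⟨q, rfl⟩
  intro I g
  obtain ⟨g', hg'⟩ := hE I (K.subtype ∘ₗ g)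
  refine ⟨(φ.codRestrict K hrange) ∘ₗ L.mkQ ∘ₗ g', fun x hx => Subtype.ext ?_⟩
  have := hφK (g ⟨x, hx⟩)
  simpa [hg' x hx] using this

theorem exists_injectiveEnvelope (A : Type u) [Ring A] (M : Type u) [AddCommGroup M]
    [Module A M] : ∃ (J : ModuleCat.{u} A) (i : M →ₗ[A] J), IsInjectiveEnvelope i := by
  let X : ModuleCat.{u} A := ModuleCat.of A M
  let E : ModuleCat.{u} A := CategoryTheory.Injective.under X
  let j : M →ₗ[A] E := (CategoryTheory.Injective.ι X).hom
  have hj : Function.Injective j :=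
    (ModuleCat.mono_iff_injective (CategoryTheory.Injective.ι X)).1 inferInstance
  have hE : Module.Injective A E := by
    have : CategoryTheory.Injective (ModuleCat.of A E) :=
      inferInstanceAs (CategoryTheory.Injective (CategoryTheory.Injective.under X))
    exact Module.injective_module_of_injective_object A E
  obtain ⟨K, hNK, hK⟩ := exists_maximal_essential (LinearMap.range j)
  refine ⟨ModuleCat.of A K, j.codRestrict K fun x => hNK ⟨x, rfl⟩,
    (baer_of_maximal_essential (Module.Baer.of_injective hE) hK).injective, ?_, ?_⟩
  · exact fun x y h => hj (congrArg Subtype.val h)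
  · intro N hN
    rw [Submodule.eq_bot_iff]
    intro x hx
    by_contra hx0
    obtain ⟨a, ⟨y, hy⟩, ha0⟩ := hK.prop x x.2 fun h => hx0 (Subtype.ext h)
    have h1 : a • x ∈ N ⊓ LinearMap.range (j.codRestrict K fun x => hNK ⟨x, rfl⟩) :=
      ⟨N.smul_mem a hx, y, Subtype.ext hy⟩
    rw [hN] at h1
    exact ha0 (congrArg Subtype.val h1)

end InjectiveEnvelope

/-! ### Matlis duality over the commutative artinian ring R. -/

section MatlisDuality

variable {R : Type v} [CommRing R] {J : Type v} [AddCommGroup J] [Module R J]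
  {i : (R ⧸ Ring.jacobson R) →ₗ[R] J}

theorem mem_maximal_of_jacobson {a : R} (ha : ∀ m : Ideal R, m.IsMaximal → a ∈ m) :
    a ∈ Ring.jacobson R := by
  rw [← Ideal.jacobson_bot, Ideal.jacobson, Submodule.mem_sInf]
  exact fun m hm => ha m hm.2

theorem IsInjectiveEnvelope.baer (hi : IsInjectiveEnvelope i) : Module.Baer R J :=
  Module.Baer.of_injective hi.injectiveModule

/-- An element of `J` generating a simple submodule lies in the image of `R / rad R`. -/
theorem IsInjectiveEnvelope.apply_mem_range (hi : IsInjectiveEnvelope i) {X : Type*}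
    [AddCommGroup X] [Module R X] [IsSimpleModule R X] (f : X →ₗ[R] J) (x : X) :
    f x ∈ LinearMap.range i := by
  by_cases hf : f = 0
  · simp [hf]
  have h1 : LinearMap.range f ⊓ LinearMap.range i ≠ ⊥ := fun h =>
    hf (LinearMap.range_eq_bot.1 (hi.essential _ h))
  obtain ⟨y, ⟨⟨z, rfl⟩, hy2⟩, hy0⟩ := Submodule.exists_mem_ne_zero_of_ne_bot h1
  have hz : z ≠ 0 := fun h => hy0 (by simp [h])
  obtain ⟨r, rfl⟩ := IsSimpleModule.toSpanSingleton_surjective R hz x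
  rw [LinearMap.toSpanSingleton_apply, map_smul]
  exact Submodule.smul_mem _ _ hy2

/-- All values of maps X → J lie in the image of R / rad R, and multiplication in that ring rescales
any nonzero map to any other. -/
theorem IsInjectiveEnvelope.length_hom_le_one (hi : IsInjectiveEnvelope i) {X : Type*}
    [AddCommGroup X] [Module R X] [IsSimpleModule R X] :
    Module.length R (X →ₗ[R] J) ≤ 1 := by
  have hX := IsSimpleModule.nontrivial R X
  obtain ⟨x, hx⟩ := exists_ne (0 : X)
  have hxs := IsSimpleModule.toSpanSingleton_surjective R hx
  obtain ⟨m, hm⟩ : ∃ m : Ideal R, m = LinearMap.ker (LinearMap.toSpanSingleton R X x) :=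
    ⟨_, rfl⟩
  have hmax : m.IsMaximal := hm ▸ IsSimpleModule.ker_toSpanSingleton_isMaximal R hx
  have hmx : ∀ r ∈ m, r • x = 0 := fun r hr => by
    simpa [hm] using hr
  rcases subsingleton_or_nontrivial (X →ₗ[R] J) with h | h
  · rw [Module.length_eq_zero]; exact zero_le_one
  suffices IsSimpleModule R (X →ₗ[R] J) by rw [Module.length_eq_one]
  rw [isSimpleModule_iff_toSpanSingleton_surjective]
  refine ⟨h, fun f hf g => ?_⟩
  have hfx : f x ≠ 0 := by
    intro h0
    apply hf
    ext y
    obtain ⟨r, rfl⟩ := hxs y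
    simp [h0]
  obtain ⟨a, ha⟩ := hi.apply_mem_range f x
  obtain ⟨b, hb⟩ := hi.apply_mem_range g x
  obtain ⟨α, rfl⟩ := Ideal.Quotient.mk_surjective a
  obtain ⟨β, rfl⟩ := Ideal.Quotient.mk_surjective b
  -- If α were in m it would annihilate f x, so α² would vanish in R / rad R; that ring is reduced,
  -- giving f x = 0.
  have hα : α ∉ m := by
    intro hαm
    have h1 : Ideal.Quotient.mk (Ring.jacobson R) (α * α) = 0 := by
      apply hi.injective
      rw [map_zero, map_mul]
      have : (Ideal.Quotient.mk (Ring.jacobson R) α) * (Ideal.Quotient.mk (Ring.jacobson R) α)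
        = α • (Ideal.Quotient.mk (Ring.jacobson R) α) := rfl
      rw [this, map_smul, ha, ← map_smul, hmx α hαm, map_zero]
    rw [Ideal.Quotient.eq_zero_iff_mem] at h1
    have h2 : α ∈ Ring.jacobson R := by
      apply mem_maximal_of_jacobson
      intro m' hm'
      rw [← Ideal.jacobson_bot, Ideal.jacobson, Submodule.mem_sInf] at h1
      rcases hm'.isPrime.mem_or_mem (h1 m' ⟨bot_le, hm'⟩) with h | h <;> exact h
    apply hfx
    rw [← ha, Ideal.Quotient.eq_zero_iff_mem.2 h2, map_zero]
  obtain ⟨t, μ, hsum⟩ := hmax.exists_inv hα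
  refine ⟨t * β, ?_⟩
  ext y
  obtain ⟨r, rfl⟩ := hxs y
  simp only [LinearMap.toSpanSingleton_apply, LinearMap.smul_apply, map_smul]
  congr 1
  -- Both sides are i applied to the class of tαβ, and tα is 1 modulo m, which annihilates X.
  have h3 : (t * β) • f x = (t * α) • g x := by
    rw [← ha, ← hb, ← map_smul i, ← map_smul i]
    congr 1
    change Ideal.Quotient.mk _ ((t * β) * α) = Ideal.Quotient.mk _ ((t * α) * β)
    congr 1
    ring
  have h4 : (t * α) • g x = g x := by
    have h5 : t * α = 1 - μ := by rw [← hsum.2]; ring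
    rw [h5, sub_smul, one_smul, ← map_smul g μ, hmx μ hsum.1, map_zero, sub_zero]
  rw [h3, h4]

/-- Induction along a composition series; left exactness of Hom(-, J) is enough for an inequality,
and inequalities are all that the counting argument below needs. -/
theorem IsInjectiveEnvelope.length_hom_le (hi : IsInjectiveEnvelope i) {X : Type*}
    [AddCommGroup X] [Module R X] (hX : IsFiniteLength R X) :
    Module.length R (X →ₗ[R] J) ≤ Module.length R X := by
  induction hX with
  | of_subsingleton => simp [Module.length_eq_zero]
  | @of_simple_quotient M _ _ N _ _ ih =>
    let p : ((M ⧸ N) →ₗ[R] J) →ₗ[R] (M →ₗ[R] J) := LinearMap.lcomp R J N.mkQ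
    let q : (M →ₗ[R] J) →ₗ[R] (N →ₗ[R] J) := LinearMap.lcomp R J N.subtype
    have hp : Function.Injective p := fun f g h => by
      apply LinearMap.cancel_right N.mkQ_surjective |>.1 h
    have hpq : Function.Exact p q := by
      intro f
      constructor
      · intro hf
        refine ⟨N.liftQ f fun x hx => ?_, ?_⟩
        · exact LinearMap.congr_fun hf ⟨x, hx⟩
        · ext x; rfl
      · rintro ⟨g, rfl⟩
        ext x
        exact (congrArg g ((Submodule.Quotient.mk_eq_zero N).2 x.2)).trans (map_zero g)
    have h1 : Function.Exact p q.rangeRestrict := by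
      intro f
      rw [← hpq f]
      exact Subtype.ext_iff
    rw [Module.length_eq_add_of_exact p q.rangeRestrict hp q.surjective_rangeRestrict h1,
      Module.length_eq_add_of_exact N.subtype N.mkQ N.injective_subtype N.mkQ_surjective
        (LinearMap.exact_subtype_mkQ N), add_comm, Module.length_eq_one R (M ⧸ N)]
    exact add_le_add
      ((Module.length_le_of_injective _ (LinearMap.range q).injective_subtype).trans ih)
      hi.length_hom_le_one

variable [IsArtinianRing R]

/-- For a maximal ideal `m` there is `α ∉ m` with `m α ⊆ rad R`. -/
theorem exists_mul_mem_jacobson (m : Ideal R) (hm : m.IsMaximal) :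
    ∃ α, α ∉ m ∧ ∀ r ∈ m, r * α ∈ Ring.jacobson R := by
  classical
  have : Fintype (MaximalSpectrum R) := Fintype.ofFinite _
  let s : Finset (MaximalSpectrum R) := Finset.univ.filter fun m' => m'.asIdeal ≠ m
  have h1 : ¬ s.inf (fun m' => m'.asIdeal) ≤ m := by
    rw [hm.isPrime.inf_le']
    rintro ⟨m', hm', hle⟩
    exact (Finset.mem_filter.1 hm').2 (m'.isMaximal.eq_of_le hm.ne_top hle)
  obtain ⟨α, hα, hαm⟩ := SetLike.not_le_iff_exists.1 h1
  refine ⟨α, hαm, fun r hr => mem_maximal_of_jacobson fun m' hm' => ?_⟩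
  by_cases h : m' = m
  · exact h ▸ Ideal.mul_mem_right _ _ hr
  · refine Ideal.mul_mem_left _ _ ?_
    have : s.inf (fun m' => m'.asIdeal) ≤ m' :=
      Finset.inf_le (f := fun m' : MaximalSpectrum R => m'.asIdeal) (b := ⟨m', hm'⟩)
        (Finset.mem_filter.2 ⟨Finset.mem_univ _, h⟩)
    exact this hα

/-- The injective envelope of `R / rad R` is a cogenerator. -/
theorem IsInjectiveEnvelope.exists_apply_ne_zero (hi : IsInjectiveEnvelope i) {X : Type*}
    [AddCommGroup X] [Module R X] {N : Submodule R X} {x : X} (hx : x ∉ N) :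
    ∃ g : X →ₗ[R] J, (∀ y ∈ N, g y = 0) ∧ g x ≠ 0 := by
  let p : R →ₗ[R] X ⧸ N := LinearMap.toSpanSingleton R _ (N.mkQ x)
  have hI : LinearMap.ker p ≠ ⊤ := by
    intro h
    have h1 : (1 : R) ∈ LinearMap.ker p := h ▸ Submodule.mem_top
    exact hx (by simpa [p] using h1)
  obtain ⟨m, hm, hle⟩ := Ideal.exists_le_maximal _ hI
  obtain ⟨α, hαm, hα⟩ := exists_mul_mem_jacobson m hm
  -- The class of α is nonzero and annihilated by m, so q factors through the cyclic module
  -- generated by the class of x; injectivity of J extends it to X/N.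
  let q : R →ₗ[R] J := LinearMap.toSpanSingleton R J (i (Ideal.Quotient.mk _ α))
  have hq : LinearMap.ker p ≤ LinearMap.ker q := by
    intro r hr
    have h1 : r • (Ideal.Quotient.mk (Ring.jacobson R) α) = 0 :=
      Ideal.Quotient.eq_zero_iff_mem.2 (hα r (hle hr))
    simp only [q, LinearMap.mem_ker, LinearMap.toSpanSingleton_apply, ← map_smul, h1, map_zero]
  obtain ⟨g, hg⟩ := hi.baer.extension_property ((LinearMap.ker p).liftQ p le_rfl)
    (LinearMap.ker_eq_bot.1 (Submodule.ker_liftQ_eq_bot _ _ _ le_rfl))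
    ((LinearMap.ker p).liftQ q hq)
  refine ⟨g ∘ₗ N.mkQ, fun y hy => ?_, ?_⟩
  · simp [(Submodule.Quotient.mk_eq_zero N).2 hy]
  · have h1 := LinearMap.congr_fun hg ((LinearMap.ker p).mkQ 1)
    have h3 : g (N.mkQ x) = i (Ideal.Quotient.mk _ α) := by
      have h4 : p 1 = N.mkQ x := by simp [p]
      have h5 : q 1 = i (Ideal.Quotient.mk _ α) := by simp [q]
      rw [← h4, ← h5]
      exact h1
    rw [LinearMap.comp_apply, h3]
    intro h0
    rw [← map_zero i] at h0
    have h2 := Ideal.Quotient.eq_zero_iff_mem.1 (hi.injective h0)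
    rw [← Ideal.jacobson_bot, Ideal.jacobson, Submodule.mem_sInf] at h2
    exact hαm (h2 m ⟨bot_le, hm⟩)

/-- A functional vanishing on the common kernel of a submodule of functionals belongs to it. -/
theorem IsInjectiveEnvelope.mem_of_forall_apply_eq_zero (hi : IsInjectiveEnvelope i) {X : Type*}
    [AddCommGroup X] [Module R X] [Module.Finite R X] (N : Submodule R (X →ₗ[R] J))
    (g : X →ₗ[R] J) (hg : ∀ x, (∀ f ∈ N, f x = 0) → g x = 0) : g ∈ N := by
  have hfin : ∀ {Y : Type _} [AddCommGroup Y] [Module R Y] [Module.Finite R Y],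
      IsFiniteLength R Y := fun {Y} _ _ _ => isFiniteLength_iff_isNoetherian_isArtinian.2
        ⟨inferInstance, inferInstance⟩
  have hHom : IsFiniteLength R (X →ₗ[R] J) := Module.length_ne_top_iff.1
    ((hi.length_hom_le hfin).trans_lt (Module.length_ne_top_iff.2 hfin).lt_top).ne
  have hNN := isFiniteLength_iff_isNoetherian_isArtinian.1 hHom
  have := hNN.1
  have := hNN.2
  let K : Submodule R X := ⨅ f ∈ N, LinearMap.ker f
  have hK : ∀ x, x ∈ K ↔ ∀ f ∈ N, f x = 0 := by simp [K, Submodule.mem_iInf]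
  -- N' consists of the functionals vanishing on the common kernel K. Its length is at most that of
  -- X/K, and X/K embeds in Hom(N, J), whose length is at most that of N; so N ≤ N' is an equality.
  let N' : Submodule R (X →ₗ[R] J) := LinearMap.range (LinearMap.lcomp R J K.mkQ)
  have hN' : ∀ h : X →ₗ[R] J, (∀ x ∈ K, h x = 0) → h ∈ N' := fun h hh =>
    ⟨K.liftQ h fun x hx => hh x hx, by ext x; rfl⟩
  have hle : N ≤ N' := fun f hf => hN' f fun x hx => (hK x).1 hx f hf
  have hlen1 : Module.length R N' ≤ Module.length R (X ⧸ K) :=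
    (Module.length_le_of_surjective _ (LinearMap.surjective_rangeRestrict _)).trans
      (hi.length_hom_le hfin)
  let ev : (X ⧸ K) →ₗ[R] (N →ₗ[R] J) := K.liftQ
    { toFun := fun x => { toFun := fun f => f.1 x
                          map_add' := fun _ _ => rfl
                          map_smul' := fun _ _ => rfl }
      map_add' := fun x y => by ext f; simp
      map_smul' := fun r x => by ext f; simp }
    (fun x hx => by ext f; exact (hK x).1 hx f f.2)
  have hev : Function.Injective ev := by
    rw [← LinearMap.ker_eq_bot]
    refine Submodule.ker_liftQ_eq_bot _ _ _ fun x hx => ?_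
    rw [hK]
    exact fun f hf => LinearMap.congr_fun (LinearMap.mem_ker.1 hx) ⟨f, hf⟩
  have hlen2 : Module.length R (X ⧸ K) ≤ Module.length R N :=
    (Module.length_le_of_injective ev hev).trans
      (hi.length_hom_le (hHom.of_injective N.injective_subtype))
  have heq : N = N' := by
    by_contra hne
    have h1 : N.comap N'.subtype ≠ ⊤ := fun h => hne (le_antisymm hle (by
      rw [Submodule.comap_subtype_eq_top] at h
      exact h))
    have h2 := Submodule.length_lt h1
    have h3 : Module.length R (N.comap N'.subtype) = Module.length R N :=
      LinearEquiv.length_eq (R := R) (Submodule.comapSubtypeEquivOfLe hle)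
    rw [h3] at h2
    exact absurd (hlen1.trans hlen2) (not_le.2 h2)
  rw [heq]
  exact hN' g fun x hx => hg x ((hK x).1 hx)

end MatlisDuality

/-! ### Uniserial modules and uniserial projectives. -/

section UniserialProjective

/-- Nonzero finitely generated projective uniserial modules. -/
structure IsUniserialProjective (A P : Type*) [Ring A] [AddCommGroup P] [Module A P] : Prop where
  projective : Module.Projective A P
  finite : Module.Finite A P
  nontrivial : Nontrivial P
  uniserial : IsUniserial A P

/-- The sum of all proper submodules. For a finitely generated uniserial module this is the
radical. -/
def properSup (A M : Type*) [Ring A] [AddCommGroup M] [Module A M] : Submodule A M :=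
  sSup {N | N ≠ ⊤}

variable {A : Type*} [Ring A]

theorem le_properSup {M : Type*} [AddCommGroup M] [Module A M] {N : Submodule A M} (h : N ≠ ⊤) :
    N ≤ properSup A M :=
  le_sSup h

theorem IsUniserial.of_injective {M N : Type*} [AddCommGroup M] [Module A M] [AddCommGroup N]
    [Module A N] (h : IsUniserial A N) (f : M →ₗ[A] N) (hf : Function.Injective f) :
    IsUniserial A M := fun X Y =>
  (h (X.map f) (Y.map f)).imp (fun h => (Submodule.map_le_map_iff_of_injective hf _ _).1 h)
    fun h => (Submodule.map_le_map_iff_of_injective hf _ _).1 h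

theorem IsUniserial.of_surjective {M N : Type*} [AddCommGroup M] [Module A M] [AddCommGroup N]
    [Module A N] (h : IsUniserial A M) (f : M →ₗ[A] N) (hf : Function.Surjective f) :
    IsUniserial A N := fun X Y =>
  (h (X.comap f) (Y.comap f)).imp (fun h => (Submodule.comap_le_comap_iff_of_surjective hf).1 h)
    fun h => (Submodule.comap_le_comap_iff_of_surjective hf).1 h

theorem properSup_ne_top {M : Type*} [AddCommGroup M] [Module A M] [Module.Finite A M]
    [Nontrivial M] (h : IsUniserial A M) : properSup A M ≠ ⊤ := by
  obtain ⟨C, hC⟩ := IsCoatomic.exists_coatom (α := Submodule A M)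
  intro htop
  apply hC.1
  rw [eq_top_iff, ← htop]
  refine sSup_le fun N hN => ?_
  rcases h C N with hle | hle
  · rcases eq_or_lt_of_le hle with rfl | hlt
    · exact le_rfl
    · exact absurd (hC.2 _ hlt) hN
  · exact hle

theorem sup_ne_top {M : Type*} [AddCommGroup M] [Module A M] (h : IsUniserial A M)
    {N N' : Submodule A M} (hN : N ≠ ⊤) (hN' : N' ≠ ⊤) : N ⊔ N' ≠ ⊤ := by
  rcases h N N' with hle | hle
  · rwa [sup_eq_right.2 hle]
  · rwa [sup_eq_left.2 hle]

/-- A map `h` into a uniserial module whose composite with some `g ≠ 0` is surjective. -/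
theorem surjective_of_comp_surjective {M N S : Type*} [AddCommGroup M] [Module A M]
    [AddCommGroup N] [Module A N] [AddCommGroup S] [Module A S] [Nontrivial S]
    (hN : IsUniserial A N) (h : M →ₗ[A] N) (g : N →ₗ[A] S)
    (hgh : Function.Surjective (g ∘ₗ h)) : Function.Surjective h := by
  rw [← LinearMap.range_eq_top]
  by_contra hne
  have hg : LinearMap.ker g ≠ ⊤ := by
    intro htop
    obtain ⟨s, hs⟩ := exists_ne (0 : S)
    obtain ⟨x, rfl⟩ := hgh s
    have h1 : h x ∈ LinearMap.ker g := htop ▸ Submodule.mem_top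
    exact hs h1
  refine sup_ne_top hN hne hg ?_
  rw [eq_top_iff]
  intro y _
  obtain ⟨x, hx⟩ := hgh (g y)
  refine Submodule.mem_sup.2 ⟨h x, ⟨x, rfl⟩, y - h x, ?_, by abel⟩
  simpa [sub_eq_zero] using hx.symm

/-- A nonzero map from a uniserial module maps proper submodules to proper submodules of its
image. -/
theorem map_lt_range {M N : Type*} [AddCommGroup M] [Module A M] [AddCommGroup N] [Module A N]
    (hM : IsUniserial A M) {f : M →ₗ[A] N} (hf : f ≠ 0) {X : Submodule A M} (hX : X ≠ ⊤) :
    X.map f < LinearMap.range f := by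
  refine lt_of_le_of_ne LinearMap.map_le_range fun heq => ?_
  have hker : LinearMap.ker f ≠ ⊤ := fun h => hf (LinearMap.ker_eq_top.1 h)
  refine sup_ne_top hM hX hker ?_
  rw [eq_top_iff]
  intro y _
  obtain ⟨x, hx, hxy⟩ : f y ∈ X.map f := heq ▸ ⟨y, rfl⟩
  refine Submodule.mem_sup.2 ⟨x, hx, y - x, ?_, by abel⟩
  simp [hxy]

/-- The kernel is a maximal submodule, and the sum of all proper submodules is still proper. -/
theorem ker_eq_properSup {M S : Type*} [AddCommGroup M] [Module A M] [Module.Finite A M]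
    [Nontrivial M] [AddCommGroup S] [Module A S] [IsSimpleModule A S] (hM : IsUniserial A M)
    {f : M →ₗ[A] S} (hf : f ≠ 0) : LinearMap.ker f = properSup A M := by
  have hs := LinearMap.surjective_of_ne_zero hf
  have hc := LinearMap.isCoatom_ker_of_surjective hs
  exact ((hc.le_iff_eq (properSup_ne_top hM)).1 (le_properSup hc.1)).symm

theorem isSimpleModule_quotient_properSup {M : Type*} [AddCommGroup M] [Module A M]
    [Module.Finite A M] [Nontrivial M] (hM : IsUniserial A M) :
    IsSimpleModule A (M ⧸ properSup A M) := by
  rw [isSimpleModule_iff_isCoatom]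
  refine ⟨properSup_ne_top hM, fun N hN => ?_⟩
  by_contra h
  exact hN.not_ge (le_properSup h)

theorem map_eq_of_surjective_properSup {M N : Type*} [AddCommGroup M] [Module A M] [AddCommGroup N]
    [Module A N] [Module.Finite A M] [Nontrivial M] (hM : IsUniserial A M) [Nontrivial N]
    {f : M →ₗ[A] N} (hf : Function.Surjective f) :
    (properSup A M).map f = properSup A N := by
  have hf0 : f ≠ 0 := by
    rintro rfl
    obtain ⟨y, hy⟩ := exists_ne (0 : N)
    obtain ⟨x, rfl⟩ := hf y
    exact hy rfl
  refine le_antisymm (le_properSup ?_) (sSup_le fun X hX => ?_)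
  · have := map_lt_range hM hf0 (properSup_ne_top hM)
    rw [LinearMap.range_eq_top.2 hf] at this
    exact this.ne
  · rw [← Submodule.map_comap_eq_of_surjective hf X]
    refine Submodule.map_mono (le_properSup fun h => hX ?_)
    rw [← Submodule.map_comap_eq_of_surjective hf X, h, Submodule.map_top,
      LinearMap.range_eq_top.2 hf]

/-- Submodules of the same finite length of a uniserial module of finite length agree. -/
theorem eq_of_length_eq {M : Type*} [AddCommGroup M] [Module A M] [IsArtinian A M]
    [IsNoetherian A M] (hM : IsUniserial A M) {N N' : Submodule A M}
    (h : Module.length A N = Module.length A N') : N = N' := by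
  have hstrict := Submodule.height_strictMono (R := A) (M := M)
  rw [Module.length_submodule, Module.length_submodule] at h
  rcases hM N N' with hle | hle
  · exact hle.eq_of_not_lt fun hlt => (hstrict hlt).ne h
  · exact (hle.eq_of_not_lt fun hlt => (hstrict hlt).ne h.symm).symm

namespace IsUniserialProjective

theorem of_equiv {P Q : Type*} [AddCommGroup P] [Module A P] [AddCommGroup Q] [Module A Q]
    (hP : IsUniserialProjective A P) (e : P ≃ₗ[A] Q) : IsUniserialProjective A Q where
  projective := have := hP.projective; Module.Projective.of_equiv e
  finite := have := hP.finite; Module.Finite.equiv e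
  nontrivial := have := hP.nontrivial; e.symm.toEquiv.nontrivial
  uniserial := hP.uniserial.of_injective e.symm.toLinearMap e.symm.injective

theorem properSup_ne_top {P : Type*} [AddCommGroup P] [Module A P]
    (hP : IsUniserialProjective A P) : properSup A P ≠ ⊤ :=
  have := hP.finite
  have := hP.nontrivial
  NakayamaAlgebra.properSup_ne_top hP.uniserial

/-- A surjection from a uniserial module onto a nonzero projective module is injective. -/
theorem injective_of_surjective {P Q : Type*} [AddCommGroup P] [Module A P] [AddCommGroup Q]
    [Module A Q] [Nontrivial Q] [Module.Projective A Q] (hP : IsUniserial A P) {f : P →ₗ[A] Q}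
    (hf : Function.Surjective f) : Function.Injective f := by
  obtain ⟨s, hs⟩ := Module.projective_lifting_property f LinearMap.id hf
  have hs' : ∀ q, f (s q) = q := LinearMap.congr_fun hs
  rw [← LinearMap.ker_eq_bot, Submodule.eq_bot_iff]
  intro x hx
  rcases hP (LinearMap.ker f) (LinearMap.range s) with hle | hle
  · obtain ⟨q, rfl⟩ := hle hx
    have h1 : q = 0 := by rw [← hs' q]; exact hx
    rw [h1, map_zero]
  · obtain ⟨q, hq⟩ := exists_ne (0 : Q)
    have h1 : f (s q) = 0 := hle ⟨q, rfl⟩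
    exact absurd ((hs' q).symm.trans h1) hq

/-- Two uniserial projective modules with a common nonzero quotient are isomorphic. -/
theorem nonempty_equiv {P Q S : Type*} [AddCommGroup P] [Module A P] [AddCommGroup Q]
    [Module A Q] [AddCommGroup S] [Module A S] [Nontrivial S] (hP : IsUniserialProjective A P)
    (hQ : IsUniserialProjective A Q) {f : P →ₗ[A] S} {g : Q →ₗ[A] S}
    (hf : Function.Surjective f) (hg : Function.Surjective g) : Nonempty (P ≃ₗ[A] Q) := by
  have := hP.projective
  have := hQ.projective
  have := hQ.nontrivial
  obtain ⟨h, hh⟩ := Module.projective_lifting_property g f hg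
  have hs : Function.Surjective h :=
    surjective_of_comp_surjective hQ.uniserial h g (by rw [hh]; exact hf)
  exact ⟨LinearEquiv.ofBijective h ⟨injective_of_surjective hP.uniserial hs, hs⟩⟩

/-- A uniserial projective module is a direct summand of the regular module. -/
theorem exists_retract {P : Type*} [AddCommGroup P] [Module A P]
    (hP : IsUniserialProjective A P) :
    ∃ (p : A →ₗ[A] P) (s : P →ₗ[A] A), p ∘ₗ s = LinearMap.id := by
  have := hP.projective
  obtain ⟨x, -, hx⟩ := SetLike.exists_of_lt hP.properSup_ne_top.lt_top
  have hsurj : Function.Surjective (LinearMap.toSpanSingleton A P x) := by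
    rw [← LinearMap.range_eq_top]
    by_contra hne
    exact hx (le_properSup hne ⟨1, by simp⟩)
  obtain ⟨s, hs⟩ := Module.projective_lifting_property _ LinearMap.id hsurj
  exact ⟨_, s, hs⟩

theorem range_le_properSup {M P : Type*} [AddCommGroup M] [Module A M] [AddCommGroup P]
    [Module A P] {f : M →ₗ[A] P} (hf : ¬ Function.Surjective f) :
    LinearMap.range f ≤ properSup A P :=
  le_properSup fun h => hf (LinearMap.range_eq_top.1 h)

end IsUniserialProjective

/-- Superfluity makes the kernel the largest proper submodule. So P is generated by any element
outside it and is not the sum of two proper submodules; being indecomposable, P is uniserial by the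
Nakayama condition. -/
theorem IsProjectiveCover.isUniserialProjective {A : Type u} [Ring A] (hA : IsNakayama A)
    {P : Type u} {S : Type*} [AddCommGroup P] [Module A P] [AddCommGroup S] [Module A S]
    [IsSimpleModule A S] {f : P →ₗ[A] S} (hf : IsProjectiveCover f) :
    IsUniserialProjective A P := by
  have hS := IsSimpleModule.nontrivial A S
  have hP := hf.projective
  have hker := LinearMap.isCoatom_ker_of_surjective hf.surjective
  have hle : ∀ N : Submodule A P, N ≠ ⊤ → N ≤ LinearMap.ker f := by
    intro N hN
    by_contra h
    exact hN (hf.superfluous N (hker.2 _ (right_lt_sup.2 h)))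
  have hfin : Module.Finite A P := by
    obtain ⟨x, -, hx⟩ := SetLike.exists_of_lt hker.1.lt_top
    refine ⟨⟨{x}, ?_⟩⟩
    by_contra hne
    exact hx (hle _ hne (Submodule.subset_span (by simp)))
  have hnt : Nontrivial P := hf.surjective.nontrivial
  refine ⟨hP, hfin, hnt, hA.projective_uniserial P hfin hP ⟨hnt, fun N N' hNN => ?_⟩⟩
  by_cases hN : N = ⊤
  · right
    subst hN
    simpa using hNN.inf_eq_bot
  by_cases hN' : N' = ⊤
  · left
    subst hN'
    simpa using hNN.inf_eq_bot
  have h1 := sup_le (hle _ hN) (hle _ hN')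
  rw [hNN.sup_eq_top] at h1
  exact absurd (top_le_iff.1 h1) hker.1

end UniserialProjective

/-! ### The duality Hom_R(-, J) between right and left modules. -/

section Duality

variable {R : Type v} [CommRing R] {A : Type u} [Ring A] [Algebra R A]
  {X : Type*} [AddCommGroup X] [Module R X] [Module Aᵐᵒᵖ X] [IsScalarTower R Aᵐᵒᵖ X]
  {J : Type v} [AddCommGroup J] [Module R J]

/-- The underlying `R`-linear map of an element of the dual. -/
def ArtinDual.toHom : ArtinDual R X J ≃+ (X →ₗ[R] J) := AddEquiv.refl _

theorem ArtinDual.smul_toHom (a : A) (g : ArtinDual R X J) (x : X) :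
    (a • g).toHom x = g.toHom (MulOpposite.op a • x) := rfl

theorem ArtinDual.toHom_symm_smul (r : R) (f : X →ₗ[R] J) :
    ArtinDual.toHom.symm (r • f) = (algebraMap R A r) • ArtinDual.toHom.symm f := by
  refine LinearMap.ext fun x => ?_
  change r • f x = f (MulOpposite.op (algebraMap R A r) • x)
  rw [← MulOpposite.algebraMap_apply, algebraMap_smul, map_smul]

theorem ArtinDual.algebraMap_smul_toHom (r : R) (g : ArtinDual R X J) :
    ((algebraMap R A r) • g).toHom = r • g.toHom := by
  ext x
  rw [ArtinDual.smul_toHom, ← MulOpposite.algebraMap_apply, algebraMap_smul, map_smul,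
    LinearMap.smul_apply]

/-- The functionals vanishing on a right submodule. -/
def ArtinDual.annihilator (J : Type v) [AddCommGroup J] [Module R J] (N : Submodule Aᵐᵒᵖ X) :
    Submodule A (ArtinDual R X J) where
  carrier := {g | ∀ x ∈ N, g.toHom x = 0}
  add_mem' {f g} hf hg x hx := by
    rw [map_add, LinearMap.add_apply, hf x hx, hg x hx, add_zero]
  zero_mem' x _ := rfl
  smul_mem' a g hg x hx := hg _ (N.smul_mem _ hx)

/-- The common kernel of a submodule of functionals. -/
def ArtinDual.commonKer (N : Submodule A (ArtinDual R X J)) : Submodule Aᵐᵒᵖ X where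
  carrier := {x | ∀ g ∈ N, g.toHom x = 0}
  add_mem' {x y} hx hy g hg := by rw [map_add, hx g hg, hy g hg, add_zero]
  zero_mem' g _ := map_zero _
  smul_mem' a x hx g hg := hx (MulOpposite.unop a • g) (N.smul_mem _ hg)

variable {i : (R ⧸ Ring.jacobson R) →ₗ[R] J}

/-- With `le_of_annihilator_le` this makes annihilators and common kernels an inclusion-reversing
correspondence of submodule lattices, which transports simplicity, uniseriality and
indecomposability. -/
theorem IsInjectiveEnvelope.mem_of_commonKer [IsArtinianRing R] [Module.Finite R X]
    (hi : IsInjectiveEnvelope i) (N : Submodule A (ArtinDual R X J)) (g : ArtinDual R X J)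
    (hg : ∀ x ∈ ArtinDual.commonKer N, g.toHom x = 0) : g ∈ N := by
  let N' : Submodule R (X →ₗ[R] J) :=
    { carrier := {f | ArtinDual.toHom.symm f ∈ N}
      add_mem' := fun hf hg => N.add_mem hf hg
      zero_mem' := N.zero_mem
      smul_mem' := fun r f hf => by
        have h1 := N.smul_mem (algebraMap R A r) hf
        change ArtinDual.toHom.symm (r • f) ∈ N
        rw [ArtinDual.toHom_symm_smul (A := A)]
        exact h1 }
  exact hi.mem_of_forall_apply_eq_zero N' g.toHom fun x hx => hg x fun f hf => hx f.toHom hf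

theorem IsInjectiveEnvelope.le_of_annihilator_le [IsArtinianRing R]
    (hi : IsInjectiveEnvelope i) {N N' : Submodule Aᵐᵒᵖ X}
    (h : ArtinDual.annihilator (R := R) J N ≤ ArtinDual.annihilator (R := R) J N') : N' ≤ N := by
  intro x hx
  by_contra hxN
  obtain ⟨g, hg, hgx⟩ := hi.exists_apply_ne_zero (N := N.restrictScalars R) hxN
  exact hgx (h (x := ArtinDual.toHom.symm g) hg x hx)

theorem IsInjectiveEnvelope.isUniserial_of_dual [IsArtinianRing R]
    (hi : IsInjectiveEnvelope i) (h : IsUniserial A (ArtinDual R X J)) :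
    IsUniserial Aᵐᵒᵖ X := fun N N' =>
  (h (ArtinDual.annihilator J N') (ArtinDual.annihilator J N)).imp hi.le_of_annihilator_le
    hi.le_of_annihilator_le

theorem IsInjectiveEnvelope.nontrivial_dual [IsArtinianRing R] [Nontrivial X]
    (hi : IsInjectiveEnvelope i) : Nontrivial (ArtinDual R X J) := by
  obtain ⟨x, hx⟩ := exists_ne (0 : X)
  obtain ⟨g, -, hg⟩ := hi.exists_apply_ne_zero (N := (⊥ : Submodule R X)) hx
  exact ⟨ArtinDual.toHom.symm g, 0, fun h => hg (LinearMap.congr_fun h x)⟩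

theorem IsInjectiveEnvelope.isSimpleModule_dual [IsArtinianRing R] [Module.Finite R X]
    (hi : IsInjectiveEnvelope i) (h : IsSimpleModule Aᵐᵒᵖ X) :
    IsSimpleModule A (ArtinDual R X J) := by
  have := IsSimpleModule.nontrivial Aᵐᵒᵖ X
  have := hi.nontrivial_dual (X := X)
  rw [isSimpleModule_iff]
  refine { eq_bot_or_eq_top := fun N => ?_ }
  rcases eq_bot_or_eq_top (ArtinDual.commonKer N) with hN | hN
  · right
    rw [eq_top_iff]
    refine fun g _ => hi.mem_of_commonKer N g fun x hx => ?_
    rw [hN, Submodule.mem_bot] at hx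
    rw [hx, map_zero]
  · left
    rw [Submodule.eq_bot_iff]
    refine fun g hg => LinearMap.ext fun x => ?_
    have h1 : x ∈ ArtinDual.commonKer N := hN ▸ Submodule.mem_top
    exact h1 g hg

theorem IsInjectiveEnvelope.isIndecomposable_dual [IsArtinianRing R] [Module.Finite R X]
    (hi : IsInjectiveEnvelope i) (h : IsIndecomposable Aᵐᵒᵖ X) :
    IsIndecomposable A (ArtinDual R X J) := by
  have := h.1
  refine ⟨hi.nontrivial_dual, fun N N' hNN => ?_⟩
  have hbot : ∀ N : Submodule A (ArtinDual R X J), ArtinDual.commonKer N = ⊤ → N = ⊥ := by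
    intro N hN
    rw [Submodule.eq_bot_iff]
    refine fun g hg => LinearMap.ext fun x => ?_
    have h1 : x ∈ ArtinDual.commonKer N := hN ▸ Submodule.mem_top
    exact h1 g hg
  have hcompl : IsCompl (ArtinDual.commonKer N) (ArtinDual.commonKer N') := by
    rw [isCompl_iff, disjoint_iff, codisjoint_iff]
    constructor
    · rw [Submodule.eq_bot_iff]
      rintro x ⟨hx, hx'⟩
      by_contra hx0
      obtain ⟨g, -, hg⟩ := hi.exists_apply_ne_zero (N := (⊥ : Submodule R X)) hx0
      obtain ⟨g1, hg1, g2, hg2, hsum⟩ := Submodule.mem_sup.1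
        (show ArtinDual.toHom.symm g ∈ N ⊔ N' from hNN.sup_eq_top ▸ Submodule.mem_top)
      apply hg
      have h2 : g = g1.toHom + g2.toHom := by
        rw [← map_add, hsum, AddEquiv.apply_symm_apply]
      rw [h2, LinearMap.add_apply, hx g1 hg1, hx' g2 hg2, add_zero]
    · rw [eq_top_iff]
      refine hi.le_of_annihilator_le fun g hg x _ => ?_
      have h1 : g ∈ N ⊓ N' := ⟨hi.mem_of_commonKer N g fun x hx => hg x (Submodule.mem_sup_left hx),
        hi.mem_of_commonKer N' g fun x hx => hg x (Submodule.mem_sup_right hx)⟩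
      rw [hNN.inf_eq_bot, Submodule.mem_bot] at h1
      rw [h1]
      rfl
  rcases h.2 _ _ hcompl with h1 | h1
  · right
    apply hbot
    simpa [h1] using hcompl.sup_eq_top
  · left
    apply hbot
    simpa [h1] using hcompl.sup_eq_top

theorem IsInjectiveEnvelope.finite_dual [IsArtinianRing R] [Module.Finite R X]
    (hi : IsInjectiveEnvelope i) : Module.Finite A (ArtinDual R X J) := by
  have hX : IsFiniteLength R X :=
    isFiniteLength_iff_isNoetherian_isArtinian.2 ⟨inferInstance, inferInstance⟩
  have hHom : IsFiniteLength R (X →ₗ[R] J) := Module.length_ne_top_iff.1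
    ((hi.length_hom_le hX).trans_lt (Module.length_ne_top_iff.2 hX).lt_top).ne
  have := (isFiniteLength_iff_isNoetherian_isArtinian.1 hHom).1
  obtain ⟨G, hG⟩ := (inferInstance : Module.Finite R (X →ₗ[R] J)).fg_top
  classical
  refine ⟨⟨G.image ArtinDual.toHom.symm, ?_⟩⟩
  rw [eq_top_iff]
  rintro g -
  have h1 : g.toHom ∈ Submodule.span R (G : Set (X →ₗ[R] J)) := hG ▸ Submodule.mem_top
  suffices h : ∀ f ∈ Submodule.span R (G : Set (X →ₗ[R] J)), ArtinDual.toHom.symm f ∈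
      Submodule.span A ((G.image ArtinDual.toHom.symm : Finset (ArtinDual R X J)) :
        Set (ArtinDual R X J)) from h _ h1
  intro f hf
  induction hf using Submodule.span_induction with
  | mem x hx => exact Submodule.subset_span (by simpa using hx)
  | zero => exact Submodule.zero_mem _
  | add x y _ _ hx hy => exact Submodule.add_mem _ hx hy
  | smul r x _ hx =>
    rw [ArtinDual.toHom_symm_smul (A := A)]
    exact Submodule.smul_mem _ (algebraMap R A r) hx

/-- The dual of a direct summand of the regular right module is injective. -/
theorem ArtinDual.baer (hJ : Module.Baer R J) (p : A →ₗ[Aᵐᵒᵖ] X) (s : X →ₗ[Aᵐᵒᵖ] A)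
    (hps : p ∘ₗ s = LinearMap.id) : Module.Baer A (ArtinDual R X J) := by
  intro I g
  have hps' : ∀ x, p (s x) = x := LinearMap.congr_fun hps
  have hs : ∀ (r : R) (x : X), s (r • x) = r • s x := fun r x =>
    LinearMap.map_smul_of_tower s r x
  -- the functional on `I` corresponding to `g`
  let ψ : I.restrictScalars R →ₗ[R] J :=
    { toFun := fun y => (g y).toHom (p 1)
      map_add' := fun y z => congrArg (fun w => ArtinDual.toHom w (p 1)) (map_add g y z)
      map_smul' := fun r y => by
        have h1 : r • y = (algebraMap R A r • y : I) := Subtype.ext (Algebra.smul_def r (y : A))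
        have h2 : g (r • y) = algebraMap R A r • g y :=
          (congrArg g h1).trans (map_smul g (algebraMap R A r) y)
        have h3 := congrArg (fun w => ArtinDual.toHom w (p 1)) h2
        rw [ArtinDual.algebraMap_smul_toHom] at h3
        exact h3 }
  obtain ⟨Ψ, hΨ⟩ := hJ.extension_property (I.restrictScalars R).subtype
    (Submodule.injective_subtype _) ψ
  have hΨ' : ∀ (y : A) (hy : y ∈ I), Ψ y = (g ⟨y, hy⟩).toHom (p 1) := fun y hy =>
    LinearMap.congr_fun hΨ ⟨y, hy⟩
  -- The extension sends a to x ↦ Ψ(s x · a). On I it returns g because p 1 · s x = p (s x) = x.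
  refine ⟨{ toFun := fun a => ArtinDual.toHom.symm
              { toFun := fun x => Ψ (s x * a)
                map_add' := fun x y => by rw [map_add, add_mul, map_add]
                map_smul' := fun r x => by
                  rw [hs, smul_mul_assoc, map_smul, RingHom.id_apply] }
            map_add' := fun a b => LinearMap.ext fun x => by
              change Ψ (s x * (a + b)) = Ψ (s x * a) + Ψ (s x * b)
              rw [mul_add, map_add]
            map_smul' := fun a b => LinearMap.ext fun x => by
              change Ψ (s x * (a * b)) = Ψ (s (MulOpposite.op a • x) * b)
              rw [map_smul, MulOpposite.smul_eq_mul_unop, MulOpposite.unop_op, mul_assoc] },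
    fun a ha => LinearMap.ext fun x => ?_⟩
  change Ψ (s x * a) = (g ⟨a, ha⟩).toHom x
  rw [hΨ' _ (I.mul_mem_left _ ha)]
  have h1 : g ⟨s x * a, I.mul_mem_left _ ha⟩ = s x • g ⟨a, ha⟩ := by
    rw [← map_smul]
    rfl
  rw [h1, ArtinDual.smul_toHom, ← map_smul, MulOpposite.smul_eq_mul_unop, one_mul,
    MulOpposite.unop_op, hps']

/-- The Nakayama condition for injective modules in any universe. -/
theorem IsNakayama.isUniserial_of_baer (hA : IsNakayama A) {M : Type*} [AddCommGroup M] [Module A M]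
    (hfin : Module.Finite A M) (hM : Module.Baer A M) (hind : IsIndecomposable A M) :
    IsUniserial A M := by
  -- A quotient of A^k isomorphic to M lives in the universe of A, where the Nakayama condition
  -- applies.
  obtain ⟨k, f, hf⟩ := Module.Finite.exists_fin' A M
  let e : ((Fin k → A) ⧸ LinearMap.ker f) ≃ₗ[A] M := f.quotKerEquivOfSurjective hf
  have h1 : IsIndecomposable A ((Fin k → A) ⧸ LinearMap.ker f) := by
    refine ⟨have := hind.1; e.toEquiv.nontrivial, fun N N' hNN => ?_⟩
    have h2 := hind.2 _ _ (hNN.map (Submodule.orderIsoMapComap e))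
    exact h2.imp (fun h => (map_eq_bot_iff (Submodule.orderIsoMapComap e)).1 h)
      fun h => (map_eq_bot_iff (Submodule.orderIsoMapComap e)).1 h
  exact (hA.injective_uniserial _ inferInstance (hM.of_equiv e.symm).injective h1).of_injective
    e.symm.toLinearMap e.symm.injective

end Duality

/-! ### Uniseriality of Hom(P, A) and factorization of maps between projectives. -/

section DualUniserial

variable {A : Type u} [Ring A]

/-- Left multiplication form of a summand of the regular module: the maps `P → A` form a summand
of the regular right module. -/
theorem exists_dual_retract {P : Type*} [AddCommGroup P] [Module A P] {p : A →ₗ[A] P}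
    {s : P →ₗ[A] A} (hps : p ∘ₗ s = LinearMap.id) :
    ∃ (p' : A →ₗ[Aᵐᵒᵖ] (P →ₗ[A] A)) (s' : (P →ₗ[A] A) →ₗ[Aᵐᵒᵖ] A),
      p' ∘ₗ s' = LinearMap.id := by
  refine ⟨{ toFun := fun a => MulOpposite.op a • s
            map_add' := fun a b => by rw [MulOpposite.op_add, add_smul]
            map_smul' := fun a b => by
              rw [RingHom.id_apply, smul_smul]
              rfl },
    { toFun := fun g => g (p 1)
      map_add' := fun _ _ => rfl
      map_smul' := fun _ _ => rfl }, ?_⟩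
  ext g x
  change s x * g (p 1) = g x
  rw [← smul_eq_mul, ← map_smul, ← map_smul, smul_eq_mul, mul_one]
  exact congrArg g (LinearMap.congr_fun hps x)

/-- A map m with p ∘ m bijective generates Hom(P, A) as a right module. If s = m + m', one of p ∘ m
and p ∘ m' is surjective, because their images add up to the uniserial module P. -/
theorem IsUniserialProjective.isIndecomposable_dual [IsNoetherianRing A] {P : Type*}
    [AddCommGroup P] [Module A P] (hP : IsUniserialProjective A P) : IsIndecomposable Aᵐᵒᵖ (P →ₗ[A] A) := by
  have := hP.finite
  have := hP.nontrivial
  obtain ⟨p, s, hps⟩ := hP.exists_retract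
  have hps' : ∀ x, p (s x) = x := LinearMap.congr_fun hps
  have key : ∀ (N : Submodule Aᵐᵒᵖ (P →ₗ[A] A)) (m : P →ₗ[A] A), m ∈ N →
      Function.Surjective (p ∘ₗ m) → N = ⊤ := by
    intro N m hm hs
    let e := LinearEquiv.ofBijective (p ∘ₗ m)
      ⟨IsNoetherian.injective_of_surjective_endomorphism _ hs, hs⟩
    rw [eq_top_iff]
    intro y _
    have h1 : y = MulOpposite.op (y (e.symm (p 1))) • m := by
      ext x
      change y x = m x * y (e.symm (p 1))
      rw [← smul_eq_mul, ← map_smul, ← map_smul, ← map_smul, smul_eq_mul, mul_one]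
      congr 1
      exact (e.symm_apply_apply x).symm
    rw [h1]
    exact N.smul_mem _ hm
  refine ⟨⟨s, 0, ?_⟩, fun N N' hNN => ?_⟩
  · rintro rfl
    obtain ⟨x, hx⟩ := exists_ne (0 : P)
    exact hx (by rw [← hps' x]; simp)
  · obtain ⟨m, hm, m', hm', hsum⟩ := Submodule.mem_sup.1
      (show s ∈ N ⊔ N' from hNN.sup_eq_top ▸ Submodule.mem_top)
    by_cases h1 : Function.Surjective (p ∘ₗ m)
    · right
      have := key N m hm h1
      subst this
      simpa using hNN.inf_eq_bot
    by_cases h2 : Function.Surjective (p ∘ₗ m')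
    · left
      have := key N' m' hm' h2
      subst this
      simpa using hNN.inf_eq_bot
    exfalso
    rw [← LinearMap.range_eq_top] at h1 h2
    refine sup_ne_top hP.uniserial h1 h2 ?_
    rw [eq_top_iff]
    intro x _
    refine Submodule.mem_sup.2 ⟨p (m x), ⟨x, rfl⟩, p (m' x), ⟨x, rfl⟩, ?_⟩
    rw [← map_add, ← LinearMap.add_apply, hsum, hps']

theorem finite_dual_of_retract {R : Type v} [CommRing R] [Algebra R A] [Module.Finite R A]
    {P : Type*} [AddCommGroup P] [Module A P] {p : A →ₗ[A] P}
    {s : P →ₗ[A] A} (hps : p ∘ₗ s = LinearMap.id) : Module.Finite R (P →ₗ[A] A) := by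
  obtain ⟨p', s', h⟩ := exists_dual_retract hps
  refine Module.Finite.of_surjective (p'.restrictScalars R) fun g => ⟨s' g, ?_⟩
  exact LinearMap.congr_fun h g

/-- The dual of Hom(P, A) is a finitely generated indecomposable injective left module. This is
where the uniseriality of injectives enters the proof. -/
theorem IsUniserialProjective.isUniserial_dual (R : Type v) [CommRing R]
    [IsArtinianRing R] [Algebra R A]
    [Module.Finite R A] (hA : IsNakayama A) {P : Type*} [AddCommGroup P]
    [Module A P] (hP : IsUniserialProjective A P) : IsUniserial Aᵐᵒᵖ (P →ₗ[A] A) := by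
  have : IsArtinianRing A := IsArtinianRing.of_finite R A
  obtain ⟨p, s, hps⟩ := hP.exists_retract
  obtain ⟨p', s', hps'⟩ := exists_dual_retract hps
  have : Module.Finite R (P →ₗ[A] A) := finite_dual_of_retract hps
  obtain ⟨J, i, hi⟩ := exists_injectiveEnvelope R (R ⧸ Ring.jacobson R)
  exact hi.isUniserial_of_dual (hA.isUniserial_of_baer hi.finite_dual
    (ArtinDual.baer hi.baer p' s' hps') (hi.isIndecomposable_dual hP.isIndecomposable_dual))

/-- The inclusion says s ∘ g = (s' ∘ h)·a, and right multiplication by a is an endomorphism of the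
left module A; compose it with s' and p. -/
theorem exists_factor_of_span_le {P Q Q' : Type*} [AddCommGroup P] [Module A P] [AddCommGroup Q]
    [Module A Q] [AddCommGroup Q'] [Module A Q'] {p : A →ₗ[A] Q} {s : Q →ₗ[A] A}
    (hps : p ∘ₗ s = LinearMap.id) {s' : Q' →ₗ[A] A} {g : P →ₗ[A] Q} {h : P →ₗ[A] Q'}
    (hle : Submodule.span Aᵐᵒᵖ {s ∘ₗ g} ≤ Submodule.span Aᵐᵒᵖ {s' ∘ₗ h}) :
    ∃ φ : Q' →ₗ[A] Q, g = φ ∘ₗ h := by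
  obtain ⟨a, ha⟩ := Submodule.mem_span_singleton.1 (hle (Submodule.mem_span_singleton_self _))
  refine ⟨p ∘ₗ LinearMap.toSpanSingleton A A (MulOpposite.unop a) ∘ₗ s', ?_⟩
  ext x
  have h1 : s' (h x) * MulOpposite.unop a = s (g x) := LinearMap.congr_fun ha x
  have h2 : p (s (g x)) = g x := LinearMap.congr_fun hps (g x)
  rw [LinearMap.comp_apply, LinearMap.comp_apply, LinearMap.comp_apply,
    LinearMap.toSpanSingleton_apply, smul_eq_mul, h1, h2]

/-- Of two maps from a uniserial projective module to uniserial projective modules, one factors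
through the other. -/
theorem IsUniserialProjective.exists_factor (R : Type v) [CommRing R]
    [IsArtinianRing R] [Algebra R A]
    [Module.Finite R A] (hA : IsNakayama A) {P Q Q' : Type*} [AddCommGroup P]
    [Module A P] [AddCommGroup Q] [Module A Q] [AddCommGroup Q'] [Module A Q']
    (hP : IsUniserialProjective A P) (hQ : IsUniserialProjective A Q)
    (hQ' : IsUniserialProjective A Q') (g : P →ₗ[A] Q) (h : P →ₗ[A] Q') :
    (∃ φ : Q' →ₗ[A] Q, g = φ ∘ₗ h) ∨ ∃ φ : Q →ₗ[A] Q', h = φ ∘ₗ g := by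
  obtain ⟨p, s, hps⟩ := hQ.exists_retract
  obtain ⟨p', s', hps'⟩ := hQ'.exists_retract
  exact (hP.isUniserial_dual R hA (Submodule.span Aᵐᵒᵖ {s ∘ₗ g})
    (Submodule.span Aᵐᵒᵖ {s' ∘ₗ h})).imp (exists_factor_of_span_le hps)
    (exists_factor_of_span_le hps')

/-- Let `d : T → P` have image the largest proper submodule of `P`. Every non-surjective map from
`T` to a uniserial projective module factors through `d`. -/
theorem IsUniserialProjective.exists_factor_of_range_eq (R : Type v) [CommRing R]
    [IsArtinianRing R] [Algebra R A]
    [Module.Finite R A] (hA : IsNakayama A) {P Q T : Type*}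
    [AddCommGroup P] [Module A P] [AddCommGroup Q] [Module A Q] [AddCommGroup T] [Module A T]
    (hT : IsUniserialProjective A T) (hP : IsUniserialProjective A P)
    (hQ : IsUniserialProjective A Q) {d : T →ₗ[A] P} (hd : LinearMap.range d = properSup A P)
    (hd0 : d ≠ 0) {y : T →ₗ[A] Q} (hy : ¬ Function.Surjective y) :
    ∃ ψ : P →ₗ[A] Q, y = ψ ∘ₗ d := by
  -- In the remaining case d = φ ∘ y. A surjective φ is invertible. Otherwise φ maps the proper
  -- submodule range y strictly inside range φ ≤ rad P, contradicting range d = rad P.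
  rcases hT.exists_factor R hA hQ hP y d with h | ⟨φ, rfl⟩
  · exact h
  by_cases hφ : Function.Surjective φ
  · have := hP.projective
    have := hP.nontrivial
    let e := LinearEquiv.ofBijective φ ⟨injective_of_surjective hQ.uniserial hφ, hφ⟩
    refine ⟨e.symm.toLinearMap, ?_⟩
    ext x
    exact (e.symm_apply_apply (y x)).symm
  · exfalso
    have hφ0 : φ ≠ 0 := by
      rintro rfl
      exact hd0 (by simp)
    have h1 := map_lt_range hQ.uniserial hφ0 (fun h => hy (LinearMap.range_eq_top.1 h))
    rw [← LinearMap.range_comp, hd] at h1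
    exact h1.not_ge (range_le_properSup hφ)

/-- The radical of a uniserial projective module determines the module. -/
theorem IsUniserialProjective.nonempty_equiv_of_range_eq (R : Type v) [CommRing R]
    [IsArtinianRing R] [Algebra R A]
    [Module.Finite R A] (hA : IsNakayama A) {P P' T : Type*}
    [AddCommGroup P] [Module A P] [AddCommGroup P'] [Module A P'] [AddCommGroup T] [Module A T]
    (hT : IsUniserialProjective A T) (hP : IsUniserialProjective A P)
    (hP' : IsUniserialProjective A P') {d : T →ₗ[A] P} (hd : LinearMap.range d = properSup A P)
    (hd0 : d ≠ 0) {d' : T →ₗ[A] P'} (hd' : LinearMap.range d' = properSup A P') (hd0' : d' ≠ 0) :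
    Nonempty (P ≃ₗ[A] P') := by
  obtain ⟨ψ, rfl⟩ := hT.exists_factor_of_range_eq R hA hP hP' hd hd0 (y := d') fun h =>
    hP'.properSup_ne_top (hd'.symm.trans (LinearMap.range_eq_top.2 h))
  have hψ0 : ψ ≠ 0 := by
    rintro rfl
    exact hd0' (by simp)
  have hψ : Function.Surjective ψ := by
    by_contra hψ
    have h1 := map_lt_range hP.uniserial hψ0 hP.properSup_ne_top
    rw [← hd, ← LinearMap.range_comp, hd'] at h1
    exact h1.not_ge (range_le_properSup hψ)
  have := hP'.projective
  have := hP'.nontrivial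
  exact ⟨LinearEquiv.ofBijective ψ ⟨injective_of_surjective hP.uniserial hψ, hψ⟩⟩

end DualUniserial

namespace ResolutionQuiver

/-! ### The simple modules and the successor permutation. -/

section Vertices

theorem eq_of_equiv {R : Type v} {A : Type u} [Ring A] {s t : ResolutionQuiver R A}
    (h : Nonempty (s.simple ≃ₗ[A] t.simple)) :
    s = t := by
  rw [← Quotient.out_eq s, ← Quotient.out_eq t]
  exact Quotient.sound h

/-- Every simple module embeds in the semisimple module A / rad A, which has finitely many isotypic
components. -/
theorem finite {R : Type v} {A : Type u} [Ring A] [IsArtinianRing A] :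
    Finite (ResolutionQuiver R A) := by
  let M := A ⧸ Ring.jacobson A
  have : IsSemisimpleModule A M := (IsArtinian.isSemisimpleModule_iff_jacobson A M).2
    (Module.jacobson_quotient_jacobson A A)
  have hsub : ∀ s : ResolutionQuiver R A, ∃ N : Submodule A M, Nonempty (N ≃ₗ[A] s.simple) := by
    intro s
    have := IsSimpleModule.nontrivial A s.simple
    obtain ⟨x, hx⟩ := exists_ne (0 : s.simple)
    have hle : Ring.jacobson A ≤ LinearMap.ker (LinearMap.toSpanSingleton A s.simple x) := by
      have := IsSimpleModule.ker_toSpanSingleton_isMaximal A hx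
      exact Ring.jacobson_le_of_isMaximal _
    let q : M →ₗ[A] s.simple := (Ring.jacobson A).liftQ _ hle
    have hq : Function.Surjective q := by
      intro y
      obtain ⟨a, ha⟩ := IsSimpleModule.toSpanSingleton_surjective A hx y
      exact ⟨Submodule.Quotient.mk a, ha⟩
    obtain ⟨N, ⟨e⟩⟩ := IsSemisimpleModule.exists_submodule_linearEquiv_quotient (LinearMap.ker q)
    exact ⟨N, ⟨e.trans (q.quotKerEquivOfSurjective hq)⟩⟩
  choose N e using hsub
  have hN : ∀ s, IsSimpleModule A (N s) := fun s => IsSimpleModule.congr (e s).some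
  let F : ResolutionQuiver R A → isotypicComponents A M := fun s =>
    ⟨isotypicComponent A M (N s), N s, hN s, rfl⟩
  refine Finite.of_injective F fun s t hst => ?_
  have h1 : isotypicComponent A M (N s) = isotypicComponent A M (N t) := congrArg Subtype.val hst
  have h2 : N s ≤ isotypicComponent A M (N t) := h1 ▸ (N s).le_isotypicComponent
  have h3 :=
    isIsotypicOfType_submodule_iff.1 (IsIsotypicOfType.isotypicComponent A M (N t)) (N s) h2
  exact eq_of_equiv ⟨(e s).some.symm.trans (h3.some.trans (e t).some)⟩

variable {R : Type v} {A : Type u} [CommRing R] [Ring A] [Algebra R A]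

theorem exists_equiv (R : Type v) [CommRing R] [Algebra R A] (X : Type u) [AddCommGroup X]
    [Module A X] [hX : IsSimpleModule A X] :
    ∃ s : ResolutionQuiver R A, Nonempty (X ≃ₗ[A] s.simple) := by
  let s : ResolutionQuiver R A := Quotient.mk (simpleSetoid A) ⟨ModuleCat.of A X, hX⟩
  have h : (simpleSetoid A).r (Quotient.out s) ⟨ModuleCat.of A X, hX⟩ :=
    Quotient.exact (Quotient.out_eq s)
  exact ⟨s, h.map LinearEquiv.symm⟩

variable [IsArtinianRing R] [Module.Finite R A]

theorem isUniserialProjective (hA : IsNakayama A) (s : ResolutionQuiver R A) :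
    IsUniserialProjective A s.proj :=
  let ⟨_, hf⟩ := s.proj_spec
  hf.isUniserialProjective hA

theorem exists_surjective (s : ResolutionQuiver R A) :
    ∃ f : s.proj →ₗ[A] s.simple, Function.Surjective f :=
  let ⟨f, hf⟩ := s.proj_spec
  ⟨f, hf.surjective⟩

theorem nonempty_equiv_of_surjective (hA : IsNakayama A) {s : ResolutionQuiver R A} {S : Type*}
    [AddCommGroup S] [Module A S] [IsSimpleModule A S] {f : s.proj →ₗ[A] S} (hf : f ≠ 0) :
    Nonempty (S ≃ₗ[A] s.simple) := by
  have hP := s.isUniserialProjective hA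
  have := hP.finite
  have := hP.nontrivial
  have := IsSimpleModule.nontrivial A s.simple
  obtain ⟨g, hg⟩ := s.exists_surjective
  have hg0 : g ≠ 0 := by
    rintro rfl
    obtain ⟨x, hx⟩ := exists_ne (0 : s.simple)
    obtain ⟨y, hy⟩ := hg x
    exact hx hy.symm
  have hker : LinearMap.ker f = LinearMap.ker g :=
    (ker_eq_properSup hP.uniserial hf).trans (ker_eq_properSup hP.uniserial hg0).symm
  exact ⟨(f.quotKerEquivOfSurjective (LinearMap.surjective_of_ne_zero hf)).symm.trans
    ((Submodule.quotEquivOfEq _ _ hker).trans (g.quotKerEquivOfSurjective hg))⟩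

theorem eq_of_ne_zero (hA : IsNakayama A) {s t : ResolutionQuiver R A} {S : Type*}
    [AddCommGroup S] [Module A S] [IsSimpleModule A S] {f : s.proj →ₗ[A] S} {g : t.proj →ₗ[A] S}
    (hf : f ≠ 0) (hg : g ≠ 0) : s = t :=
  eq_of_equiv ⟨(nonempty_equiv_of_surjective hA hf).some.symm.trans
    (nonempty_equiv_of_surjective hA hg).some⟩

/-- Projective covers of simple modules with a common nonzero quotient agree. -/
theorem eq_of_surjective (hA : IsNakayama A) {s t : ResolutionQuiver R A} {M : Type*}
    [AddCommGroup M] [Module A M] [Nontrivial M] {f : s.proj →ₗ[A] M} {g : t.proj →ₗ[A] M}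
    (hf : Function.Surjective f) (hg : Function.Surjective g) : s = t := by
  obtain ⟨e⟩ := (s.isUniserialProjective hA).nonempty_equiv (t.isUniserialProjective hA) hf hg
  have := IsSimpleModule.nontrivial A t.simple
  obtain ⟨q, hq⟩ := t.exists_surjective
  have hne : ∀ {P : Type _} [AddCommGroup P] [Module A P] {q : P →ₗ[A] t.simple},
      Function.Surjective q → q ≠ 0 := by
    rintro P _ _ _ hq rfl
    obtain ⟨x, hx⟩ := exists_ne (0 : t.simple)
    obtain ⟨y, hy⟩ := hq x
    exact hx hy.symm
  exact eq_of_ne_zero hA (f := q ∘ₗ e.toLinearMap) (g := q) (hne (hq.comp e.surjective)) (hne hq)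

/-- Every module with a simple quotient admits a compatible nonzero map from some `P(S)`. -/
theorem exists_lift {M X : Type*} [AddCommGroup M] [Module A M] [AddCommGroup X] [Module A X]
    [IsSimpleModule A X] {g : M →ₗ[A] X} (hg : Function.Surjective g) :
    ∃ (s : ResolutionQuiver R A) (f : s.proj →ₗ[A] M), Function.Surjective (g ∘ₗ f) := by
  have := IsSimpleModule.nontrivial A X
  obtain ⟨x, hx⟩ := exists_ne (0 : X)
  -- X may live in any universe, so it is replaced by an isomorphic quotient of A.
  let e := (LinearMap.toSpanSingleton A X x).quotKerEquivOfSurjective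
    (IsSimpleModule.toSpanSingleton_surjective A hx)
  have : IsSimpleModule A (A ⧸ LinearMap.ker (LinearMap.toSpanSingleton A X x)) :=
    IsSimpleModule.congr e
  obtain ⟨s, ⟨e'⟩⟩ := exists_equiv (A := A) R (A ⧸ LinearMap.ker (LinearMap.toSpanSingleton A X x))
  obtain ⟨p, hp⟩ := s.proj_spec
  have := hp.projective
  obtain ⟨f, hf⟩ := Module.projective_lifting_property g
    ((e'.symm.trans e).toLinearMap ∘ₗ p) hg
  exact ⟨s, f, by rw [hf]; exact (e'.symm.trans e).surjective.comp hp.surjective⟩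

/-- The relation `rad P(s)` is a quotient of `P(t)`. -/
def Covers (t s : ResolutionQuiver R A) : Prop :=
  ∃ d : t.proj →ₗ[A] s.proj, LinearMap.range d = properSup A s.proj

/-- The vertex t is the top of rad P(s). When rad P(s) = 0 the zero map makes every vertex a cover
of s, so the choice is free. -/
theorem exists_covers (hA : IsNakayama A) (s : ResolutionQuiver R A) :
    ∃ t : ResolutionQuiver R A, Covers t s := by
  have : IsArtinianRing A := IsArtinianRing.of_finite R A
  have hP := s.isUniserialProjective hA
  have := hP.finite
  by_cases h : properSup A s.proj = ⊥
  · exact ⟨s, 0, by rw [h, LinearMap.range_zero]⟩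
  have hnt : Nontrivial (properSup A s.proj) := Submodule.nontrivial_iff_ne_bot.2 h
  have hu : IsUniserial A (properSup A s.proj) :=
    hP.uniserial.of_injective _ (Submodule.injective_subtype _)
  have hsimple := isSimpleModule_quotient_properSup hu
  have hnt' := IsSimpleModule.nontrivial A (properSup A s.proj ⧸ properSup A (properSup A s.proj))
  obtain ⟨t, f, hf⟩ := exists_lift (R := R) (properSup A (properSup A s.proj)).mkQ_surjective
  have hfs := surjective_of_comp_surjective hu f _ hf
  refine ⟨t, (properSup A s.proj).subtype ∘ₗ f, ?_⟩
  rw [LinearMap.range_comp, LinearMap.range_eq_top.2 hfs, Submodule.map_top,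
    Submodule.range_subtype]

theorem Covers.right_unique (hA : IsNakayama A) {s s' t : ResolutionQuiver R A}
    (hs : properSup A s.proj ≠ ⊥) (hs' : properSup A s'.proj ≠ ⊥) (h : Covers t s)
    (h' : Covers t s') : s = s' := by
  obtain ⟨d, hd⟩ := h
  obtain ⟨d', hd'⟩ := h'
  have hne : ∀ {s : ResolutionQuiver R A} {d : t.proj →ₗ[A] s.proj},
      properSup A s.proj ≠ ⊥ → LinearMap.range d = properSup A s.proj → d ≠ 0 := by
    rintro s _ hs hd rfl
    exact hs (by rw [← hd, LinearMap.range_zero])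
  obtain ⟨e⟩ := (t.isUniserialProjective hA).nonempty_equiv_of_range_eq R hA
    (s.isUniserialProjective hA) (s'.isUniserialProjective hA) hd (hne hs hd) hd' (hne hs' hd')
  have := (s'.isUniserialProjective hA).nontrivial
  exact eq_of_surjective hA (f := e.toLinearMap) (g := LinearMap.id) e.surjective
    Function.surjective_id

theorem projective_simple_iff (hA : IsNakayama A) (s : ResolutionQuiver R A) :
    Module.Projective A s.simple ↔ properSup A s.proj = ⊥ := by
  have hP := s.isUniserialProjective hA
  have := hP.projective
  have := hP.finite
  have := hP.nontrivial
  have := IsSimpleModule.nontrivial A s.simple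
  obtain ⟨q, hq⟩ := s.exists_surjective
  have hq0 : q ≠ 0 := by
    rintro rfl
    obtain ⟨x, hx⟩ := exists_ne (0 : s.simple)
    obtain ⟨y, hy⟩ := hq x
    exact hx hy.symm
  rw [← ker_eq_properSup hP.uniserial hq0]
  constructor
  · intro h
    exact LinearMap.ker_eq_bot.2 (IsUniserialProjective.injective_of_surjective hP.uniserial hq)
  · intro h
    exact Module.Projective.of_equiv (LinearEquiv.ofBijective q ⟨LinearMap.ker_eq_bot.1 h, hq⟩)

/-- The permutations of the simple modules sending every nonprojective simple module `S` to the
top of `rad P(S)`. -/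
def IsSuccessor (σ : Equiv.Perm (ResolutionQuiver R A)) : Prop := ∀ s, Covers (σ s) s

/-- Choosing covers is injective on nonprojective simples by `Covers.right_unique`, and a partial
injection of a finite set extends to a permutation; projective simples impose no condition. -/
theorem exists_isSuccessor (hA : IsNakayama A) :
    ∃ σ : Equiv.Perm (ResolutionQuiver R A), IsSuccessor σ := by
  classical
  have : IsArtinianRing A := IsArtinianRing.of_finite R A
  have : Finite (ResolutionQuiver R A) := finite
  choose ρ hρ using fun s : ResolutionQuiver R A => exists_covers hA s
  have hinj : Function.Injective
      fun s : {s : ResolutionQuiver R A // properSup A s.proj ≠ ⊥} => ρ s := by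
    intro s t hst
    exact Subtype.ext (Covers.right_unique hA s.2 t.2 (hρ s)
      ((show ρ t = ρ s from hst.symm) ▸ hρ t))
  obtain ⟨σ, hσ⟩ : ∃ σ : Equiv.Perm (ResolutionQuiver R A),
      ∀ s : ResolutionQuiver R A, properSup A s.proj ≠ ⊥ → σ s = ρ s := by
    obtain ⟨σ, hσ⟩ := Equiv.Perm.exists_extending_pair Subtype.val _ Subtype.val_injective hinj
    exact ⟨σ, fun s hs => hσ ⟨s, hs⟩⟩
  refine ⟨σ, fun s => ?_⟩
  by_cases hs : properSup A s.proj = ⊥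
  · exact ⟨0, by rw [hs, LinearMap.range_zero]⟩
  · rw [hσ s hs]
    exact hρ s

theorem length_map_properSup {M N : Type*} [AddCommGroup M] [Module A M] [Module.Finite A M]
    [Nontrivial M] [AddCommGroup N] [Module A N] (hM : IsUniserial A M) {f : M →ₗ[A] N}
    (hf : f ≠ 0) :
    Module.length A ((properSup A M).map f) + 1 = Module.length A (LinearMap.range f) := by
  have hnt : Nontrivial (LinearMap.range f) :=
    Submodule.nontrivial_iff_ne_bot.2 fun h => hf (LinearMap.range_eq_bot.1 h)
  have hu : IsUniserial A (LinearMap.range f) :=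
    hM.of_surjective f.rangeRestrict f.surjective_rangeRestrict
  have h1 := map_eq_of_surjective_properSup hM f.surjective_rangeRestrict
  have h2 := isSimpleModule_quotient_properSup hu
  have h3 : (properSup A M).map f = (properSup A (LinearMap.range f)).map
      (LinearMap.range f).subtype := by
    rw [← h1, ← Submodule.map_comp]
    rfl
  rw [h3, ← LinearEquiv.length_eq ((properSup A (LinearMap.range f)).equivMapOfInjective
    (LinearMap.range f).subtype (Submodule.injective_subtype _)),
    Module.length_eq_add_of_exact (properSup A (LinearMap.range f)).subtype
      (properSup A (LinearMap.range f)).mkQ (Submodule.injective_subtype _)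
      (Submodule.mkQ_surjective _) (LinearMap.exact_subtype_mkQ _), Module.length_eq_one A (_ ⧸ _)]

/-- The composition length of `P(S)`. -/
noncomputable def len (s : ResolutionQuiver R A) : ℕ := (Module.length A s.proj).toNat

theorem length_ne_top (M : Type*) [AddCommGroup M] [Module A M] [IsArtinianRing A]
    [Module.Finite A M] : Module.length A M ≠ ⊤ :=
  Module.length_ne_top

theorem coe_len (hA : IsNakayama A) (s : ResolutionQuiver R A) :
    (s.len : ℕ∞) = Module.length A s.proj := by
  have : IsArtinianRing A := IsArtinianRing.of_finite R A
  have := (s.isUniserialProjective hA).finite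
  exact ENat.natCast_toNat (length_ne_top _)

theorem len_pos (hA : IsNakayama A) (s : ResolutionQuiver R A) : 0 < s.len := by
  have := (s.isUniserialProjective hA).nontrivial
  have h : 0 < Module.length A s.proj := Module.length_pos
  rw [← coe_len hA] at h
  exact_mod_cast h

/-- Composing l covering maps lowers the length of the image by one each time. Hence the successive
layers of P(s), from the top, are s, σ s, σ² s, and so on. -/
theorem IsSuccessor.exists_length_range (hA : IsNakayama A)
    {σ : Equiv.Perm (ResolutionQuiver R A)} (hσ : IsSuccessor σ) (s : ResolutionQuiver R A) (l : ℕ)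
    (hl : l ≤ s.len) :
    ∃ D : ((σ ^ l) s).proj →ₗ[A] s.proj, Module.length A (LinearMap.range D) + l = s.len := by
  induction l with
  | zero =>
    rw [pow_zero, Equiv.Perm.one_apply]
    refine ⟨LinearMap.id, ?_⟩
    rw [LinearMap.range_id, Module.length_top, coe_len hA]
    simp
  | succ l ih =>
    obtain ⟨D, hD⟩ := ih (by omega)
    obtain ⟨d, hd⟩ := hσ ((σ ^ l) s)
    have hP := ((σ ^ l) s).isUniserialProjective hA
    have := hP.finite
    have := hP.nontrivial
    have hD0 : D ≠ 0 := by
      rintro rfl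
      rw [LinearMap.range_zero, Module.length_bot, zero_add] at hD
      have : l = s.len := by exact_mod_cast hD
      omega
    have h1 := length_map_properSup hP.uniserial hD0
    rw [← hd, ← LinearMap.range_comp] at h1
    rw [pow_succ', Equiv.Perm.mul_apply]
    refine ⟨D ∘ₗ d, ?_⟩
    rw [← hD, ← h1]
    push_cast
    ring

/-- P(σ s) maps onto rad P(s), which has length len s - 1. This is what makes the lift monotone. -/
theorem IsSuccessor.len_le (hA : IsNakayama A) {σ : Equiv.Perm (ResolutionQuiver R A)}
    (hσ : IsSuccessor σ) (s : ResolutionQuiver R A) : s.len ≤ (σ s).len + 1 := by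
  obtain ⟨D, hD⟩ := hσ.exists_length_range hA s 1 (s.len_pos hA)
  have h1 := Module.length_le_of_surjective D.rangeRestrict D.surjective_rangeRestrict
  have h2 : (s.len : ℕ∞) ≤ (σ s).len + 1 := by
    rw [← hD, coe_len hA (σ s)]
    exact add_le_add_left h1 1
  exact_mod_cast h2

end Vertices

/-! ### Connectedness of the algebra makes the successor permutation transitive. -/

section Transitivity

theorem perm_pow_mem_iff {V : Type*} {σ : Equiv.Perm V} {W : Set V} (hW : ∀ s, σ s ∈ W ↔ s ∈ W)
    (l : ℕ) (s : V) : (σ ^ l) s ∈ W ↔ s ∈ W := by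
  induction l with
  | zero => rfl
  | succ l ih => rw [pow_succ', Equiv.Perm.mul_apply, hW, ih]

variable {R : Type v} {A : Type u} [CommRing R] [IsArtinianRing R] [Ring A] [Algebra R A]
  [Module.Finite R A]

/-- There are no nonzero maps between projective modules lying over different orbits. -/
theorem IsSuccessor.eq_zero_of_notMem (hA : IsNakayama A) {σ : Equiv.Perm (ResolutionQuiver R A)}
    (hσ : IsSuccessor σ) {W : Set (ResolutionQuiver R A)} (hW : ∀ s, σ s ∈ W ↔ s ∈ W)
    {s t : ResolutionQuiver R A} (hst : ¬ (s ∈ W ↔ t ∈ W)) (f : s.proj →ₗ[A] t.proj) : f = 0 := by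
  have : IsArtinianRing A := IsArtinianRing.of_finite R A
  by_contra hf
  have hP := t.isUniserialProjective hA
  have := hP.finite
  have hnt : Nontrivial (LinearMap.range f) :=
    Submodule.nontrivial_iff_ne_bot.2 fun h => hf (LinearMap.range_eq_bot.1 h)
  obtain ⟨k, hk⟩ := ENat.ne_top_iff_exists.1 (length_ne_top (A := A) (LinearMap.range f))
  have hkle : k ≤ t.len := by
    have h1 := Module.length_le_of_injective _ (LinearMap.range f).injective_subtype
    rw [← hk, ← coe_len hA] at h1
    exact_mod_cast h1
  -- A submodule of the uniserial P(t) is determined by its length, so the image of f is a quotient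
  -- of some P(σ^j t); then s = σ^j t.
  obtain ⟨D, hD⟩ := hσ.exists_length_range hA t (t.len - k) (Nat.sub_le _ _)
  have hlen : Module.length A (LinearMap.range D) = Module.length A (LinearMap.range f) := by
    obtain ⟨k', hk'⟩ := ENat.ne_top_iff_exists.1 (length_ne_top (A := A) (LinearMap.range D))
    rw [← hk'] at hD ⊢
    rw [← hk]
    have h2 : k' + (t.len - k) = t.len := by exact_mod_cast hD
    have h3 : k' = k := by omega
    rw [h3]
  have hrange := eq_of_length_eq hP.uniserial hlen
  have h4 : ∃ g : ((σ ^ (t.len - k)) t).proj →ₗ[A] LinearMap.range f, Function.Surjective g := by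
    rw [← hrange]
    exact ⟨D.rangeRestrict, D.surjective_rangeRestrict⟩
  obtain ⟨g, hg⟩ := h4
  have h5 := eq_of_surjective hA f.surjective_rangeRestrict hg
  exact hst (h5 ▸ perm_pow_mem_iff hW _ t)

/-- The trace in the regular module of the projective covers of a set of simple modules. -/
def trace (W : Set (ResolutionQuiver R A)) : Submodule A A :=
  Submodule.span A {a | ∃ s ∈ W, ∃ (f : s.proj →ₗ[A] A) (p : s.proj), f p = a}

/-- A maximal left ideal m containing the sum would contain the image of every map P(s) → A, yet
some such map is onto A/m. -/
theorem trace_sup_trace_compl (W : Set (ResolutionQuiver R A)) : trace W ⊔ trace Wᶜ = ⊤ := by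
  by_contra hne
  obtain ⟨m, hm, hle⟩ := Ideal.exists_le_maximal _ hne
  have hsimple : IsSimpleModule A (A ⧸ m) := isSimpleModule_iff_isCoatom.2 hm.1
  have := IsSimpleModule.nontrivial A (A ⧸ m)
  obtain ⟨s, f, hf⟩ := exists_lift (R := R) (Submodule.mkQ_surjective m)
  obtain ⟨y, hy⟩ := exists_ne (0 : A ⧸ m)
  obtain ⟨p, rfl⟩ := hf y
  apply hy
  have h1 : f p ∈ trace W ⊔ trace Wᶜ := by
    by_cases hs : s ∈ W
    · exact Submodule.mem_sup_left (Submodule.subset_span ⟨s, hs, f, p, rfl⟩)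
    · exact Submodule.mem_sup_right (Submodule.subset_span ⟨s, hs, f, p, rfl⟩)
  exact (Submodule.Quotient.mk_eq_zero m).2 (hle h1)

theorem IsSuccessor.mul_eq_zero_of_mem_trace (hA : IsNakayama A)
    {σ : Equiv.Perm (ResolutionQuiver R A)} (hσ : IsSuccessor σ)
    {W : Set (ResolutionQuiver R A)} (hW : ∀ s, σ s ∈ W ↔ s ∈ W) {W' : Set (ResolutionQuiver R A)}
    (hWW : ∀ s ∈ W, ∀ t ∈ W', ¬ (s ∈ W ↔ t ∈ W)) {x y : A} (hx : x ∈ trace W)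
    (hy : y ∈ trace W') : x * y = 0 := by
  -- The extra factor a absorbs the scalars met in the inductions. For x = f p and y = g q the
  -- product is g(f(p)·a·q), and p ↦ f(p)·a·q is a map P(s) → P(t), hence zero.
  suffices h : ∀ a : A, x * (a * y) = 0 by simpa using h 1
  induction hx using Submodule.span_induction with
  | mem x hx =>
    obtain ⟨s, hs, f, p, rfl⟩ := hx
    induction hy using Submodule.span_induction with
    | mem y hy =>
      obtain ⟨t, ht, g, q, rfl⟩ := hy
      intro a
      have h1 := hσ.eq_zero_of_notMem hA hW (hWW s hs t ht)
        (LinearMap.toSpanSingleton A t.proj (a • q) ∘ₗ f)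
      have h2 : f p • a • q = 0 := LinearMap.congr_fun h1 p
      rw [← smul_eq_mul a, ← smul_eq_mul (f p), ← map_smul, ← map_smul, h2, map_zero]
    | zero => simp
    | add y z _ _ hy hz => intro a; rw [mul_add, mul_add, hy, hz, add_zero]
    | smul b y _ hy => intro a; rw [smul_eq_mul, ← mul_assoc a, hy]
  | zero => simp
  | add x z _ _ hx hz => intro a; rw [add_mul, hx, hz, add_zero]
  | smul b x _ hx => intro a; rw [smul_eq_mul, mul_assoc, hx, mul_zero]

/-- Over a connected algebra a set of vertices closed under successors and predecessors is
trivial. -/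
theorem IsSuccessor.mem_of_mem (hconn : IsConnectedRing A) (hA : IsNakayama A)
    {σ : Equiv.Perm (ResolutionQuiver R A)} (hσ : IsSuccessor σ)
    {W : Set (ResolutionQuiver R A)} (hW : ∀ s, σ s ∈ W ↔ s ∈ W) {s t : ResolutionQuiver R A}
    (hs : s ∈ W) : t ∈ W := by
  -- The two traces annihilate each other, so e is a central idempotent acting as 1 on one and as 0
  -- on the other. Both are nonzero if W is neither empty nor everything.
  obtain ⟨e, he, e', he', hsum⟩ := Submodule.mem_sup.1
    (show (1 : A) ∈ trace W ⊔ trace Wᶜ from trace_sup_trace_compl W ▸ Submodule.mem_top)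
  have h12 : ∀ x ∈ trace W, ∀ y ∈ trace Wᶜ, x * y = 0 := fun x hx y hy =>
    hσ.mul_eq_zero_of_mem_trace hA hW (W' := Wᶜ) (fun s hs t ht h => ht (h.1 hs)) hx hy
  have h21 : ∀ x ∈ trace Wᶜ, ∀ y ∈ trace W, x * y = 0 := fun x hx y hy =>
    hσ.mul_eq_zero_of_mem_trace hA (W := Wᶜ) (fun s => not_congr (hW s))
      (fun s hs t ht h => h.1 hs ht) hx hy
  have hleft : ∀ x ∈ trace W, e * x = x := fun x hx => by
    conv_rhs => rw [← one_mul x, ← hsum, add_mul, h21 e' he' x hx, add_zero]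
  have hright : ∀ x ∈ trace W, x * e = x := fun x hx => by
    conv_rhs => rw [← mul_one x, ← hsum, mul_add, h12 x hx e' he', add_zero]
  have hcenter : e ∈ Subring.center A := by
    rw [Subring.mem_center_iff]
    intro a
    obtain ⟨x, hx, y, hy, rfl⟩ := Submodule.mem_sup.1
      (show a ∈ trace W ⊔ trace Wᶜ from trace_sup_trace_compl W ▸ Submodule.mem_top)
    rw [add_mul, mul_add, hleft x hx, hright x hx, h12 e he y hy, h21 y hy e he]
  have hnonzero : ∀ {W : Set (ResolutionQuiver R A)} {s}, s ∈ W → ∃ x ∈ trace W, x ≠ 0 := by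
    intro W s hs
    have := (s.isUniserialProjective hA).nontrivial
    obtain ⟨p, hp⟩ := exists_ne (0 : s.proj)
    exact ⟨p, Submodule.subset_span ⟨s, hs, s.proj.subtype, p, rfl⟩, fun h => hp (Subtype.ext h)⟩
  rcases hconn.2 e hcenter (hleft e he) with h0 | h1
  · obtain ⟨x, hx, hx0⟩ := hnonzero hs
    exact absurd (by rw [← hleft x hx, h0, zero_mul]) hx0
  · by_contra ht
    obtain ⟨y, hy, hy0⟩ := hnonzero (W := Wᶜ) ht
    exact hy0 (by rw [← one_mul y, ← h1, h12 e he y hy])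

theorem IsSuccessor.sameCycle (hconn : IsConnectedRing A) (hA : IsNakayama A)
    {σ : Equiv.Perm (ResolutionQuiver R A)} (hσ : IsSuccessor σ) (s t : ResolutionQuiver R A) :
    σ.SameCycle s t :=
  hσ.mem_of_mem hconn hA (W := {t | σ.SameCycle s t})
    (fun _ => Equiv.Perm.sameCycle_apply_right) (Equiv.Perm.SameCycle.refl σ s)

/-- A connected Nakayama algebra has at most one simple projective module. -/
theorem IsSuccessor.eq_of_properSup_eq_bot (hconn : IsConnectedRing A) (hA : IsNakayama A)
    {σ : Equiv.Perm (ResolutionQuiver R A)} (hσ : IsSuccessor σ) {p q : ResolutionQuiver R A}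
    (hp : properSup A p.proj = ⊥) (hq : properSup A q.proj = ⊥) : p = q := by
  classical
  by_contra hne
  have : IsArtinianRing A := IsArtinianRing.of_finite R A
  have : Finite (ResolutionQuiver R A) := finite
  have := Fintype.ofFinite (ResolutionQuiver R A)
  -- The successor condition is empty at p and q, so exchanging their images keeps it. Both
  -- permutations are then transitive, hence full cycles of the same sign, although they differ by a
  -- transposition.
  have hσ' : IsSuccessor (σ * Equiv.swap p q) := by
    intro s
    by_cases hs : properSup A s.proj = ⊥
    · exact ⟨0, by rw [hs, LinearMap.range_zero]⟩
    · have hsp : s ≠ p := fun h => hs (h ▸ hp)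
      have hsq : s ≠ q := fun h => hs (h ▸ hq)
      rw [Equiv.Perm.mul_apply, Equiv.swap_apply_of_ne_of_ne hsp hsq]
      exact hσ s
  have key : ∀ {τ : Equiv.Perm (ResolutionQuiver R A)}, IsSuccessor τ →
      Equiv.Perm.sign τ = -(-1) ^ Fintype.card (ResolutionQuiver R A) := by
    intro τ hτ
    have hmove : ∀ s, τ s ≠ s := by
      intro s hs
      have h1 : ∀ t, s = t := fun t =>
        (Equiv.Perm.SameCycle.eq_of_left (hτ.sameCycle hconn hA s t) hs)
      exact hne ((h1 p).symm.trans (h1 q))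
    have hcyc : τ.IsCycle := ⟨p, hmove p, fun t _ => hτ.sameCycle hconn hA p t⟩
    have hsupp : τ.support = Finset.univ := by
      ext s
      simp [hmove s]
    rw [hcyc.sign, hsupp, Finset.card_univ]
  have h1 := key hσ
  have h2 := key hσ'
  rw [Equiv.Perm.sign_mul, Equiv.Perm.sign_swap hne, h1] at h2
  revert h2
  generalize -(-1 : ℤˣ) ^ Fintype.card (ResolutionQuiver R A) = ε
  intro h2
  rw [mul_neg, mul_one] at h2
  rcases Int.units_eq_one_or ε with rfl | rfl <;> exact absurd h2 (by decide)

end Transitivity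

end ResolutionQuiver

/-! ### The transpose of a nonprojective simple module. -/

section Transpose

theorem surjective_ne_zero {A M N : Type*} [Ring A] [AddCommGroup M] [Module A M] [AddCommGroup N]
    [Module A N] [Nontrivial N] {f : M →ₗ[A] N} (hf : Function.Surjective f) : f ≠ 0 := by
  rintro rfl
  obtain ⟨y, hy⟩ := exists_ne (0 : N)
  obtain ⟨x, rfl⟩ := hf y
  exact hy rfl

variable {A : Type u} [Ring A] {P₀ P₁ : Type*} [AddCommGroup P₀] [Module A P₀] [AddCommGroup P₁]
  [Module A P₁]

/-- If s = h ∘ d, then p ∘ h is a retraction of d; as a surjection from a uniserial module onto a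
projective one it is bijective, which would make d surjective. -/
theorem notMem_range_dualMap (h₀ : IsUniserialProjective A P₀) (h₁ : IsUniserialProjective A P₁)
    {d : P₁ →ₗ[A] P₀} (hd : LinearMap.range d = properSup A P₀) {p : A →ₗ[A] P₁} {s : P₁ →ₗ[A] A}
    (hps : p ∘ₗ s = LinearMap.id) : s ∉ LinearMap.range (dualMap d) := by
  rintro ⟨h, rfl⟩
  have := h₁.projective
  have := h₁.nontrivial
  have hr : ∀ x, (p ∘ₗ h) (d x) = x := LinearMap.congr_fun hps
  have hinj := IsUniserialProjective.injective_of_surjective h₀.uniserial (f := p ∘ₗ h)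
    fun x => ⟨d x, hr x⟩
  apply h₀.properSup_ne_top
  rw [← hd, LinearMap.range_eq_top]
  exact fun y => ⟨(p ∘ₗ h) y, hinj (hr _)⟩

/-- A map `x : P₁ → A` not factoring through `d : P₁ → P₀` is a split monomorphism. -/
theorem exists_comp_eq_id {R : Type v} [CommRing R] [IsArtinianRing R] [Algebra R A]
    [Module.Finite R A] (hA : IsNakayama A) (h₀ : IsUniserialProjective A P₀)
    (h₁ : IsUniserialProjective A P₁) {d : P₁ →ₗ[A] P₀} (hd : LinearMap.range d = properSup A P₀)
    (hd0 : d ≠ 0) {x : P₁ →ₗ[A] A} (hx : x ∉ LinearMap.range (dualMap d)) :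
    ∃ φ : A →ₗ[A] P₁, φ ∘ₗ x = LinearMap.id := by
  by_contra hφ
  -- If x does not split, h ∘ x is never surjective, so it factors through d. Since the trace of all
  -- P(s) is A, the identity of A is a sum of maps A → P(s) → A, and x itself factors through d.
  have key : ∀ (s : ResolutionQuiver R A) (h : A →ₗ[A] s.proj),
      ∃ ψ : P₀ →ₗ[A] s.proj, h ∘ₗ x = ψ ∘ₗ d := by
    intro s h
    have hs := s.isUniserialProjective hA
    have := hs.projective
    have := hs.nontrivial
    refine h₁.exists_factor_of_range_eq R hA h₀ hs hd hd0 fun hsurj => hφ ?_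
    let e := LinearEquiv.ofBijective (h ∘ₗ x)
      ⟨IsUniserialProjective.injective_of_surjective h₁.uniserial hsurj, hsurj⟩
    refine ⟨e.symm.toLinearMap ∘ₗ h, ?_⟩
    ext y
    exact e.symm_apply_apply y
  have h1 : (1 : A) ∈ ResolutionQuiver.trace (Set.univ : Set (ResolutionQuiver R A)) := by
    have h2 := ResolutionQuiver.trace_sup_trace_compl (Set.univ : Set (ResolutionQuiver R A))
    have h3 : ResolutionQuiver.trace (Set.univ : Set (ResolutionQuiver R A))ᶜ = ⊥ := by
      simp [ResolutionQuiver.trace]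
    rw [h3, sup_bot_eq] at h2
    exact h2 ▸ Submodule.mem_top
  have h4 : ∀ a ∈ ResolutionQuiver.trace (Set.univ : Set (ResolutionQuiver R A)), ∀ b : A,
      MulOpposite.op (b * a) • x ∈ LinearMap.range (dualMap d) := by
    intro a ha
    induction ha using Submodule.span_induction with
    | mem a ha =>
      obtain ⟨s, -, f, q, rfl⟩ := ha
      intro b
      obtain ⟨ψ, hψ⟩ := key s (LinearMap.toSpanSingleton A s.proj (b • q))
      refine ⟨f ∘ₗ ψ, ?_⟩
      ext y
      have h5 : x y • b • q = ψ (d y) := LinearMap.congr_fun hψ y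
      change f (ψ (d y)) = x y * (b * f q)
      rw [← h5, map_smul, map_smul, smul_eq_mul, smul_eq_mul]
    | zero => simp
    | add a a' _ _ h h' =>
      intro b
      rw [mul_add, MulOpposite.op_add, add_smul]
      exact Submodule.add_mem _ (h b) (h' b)
    | smul c a _ h =>
      intro b
      rw [smul_eq_mul, ← mul_assoc]
      exact h _
  apply hx
  simpa using h4 1 h1 1

/-- Any x outside the image of `dualMap d` is a split monomorphism, and such an x generates Hom(P₁,
A) as a right module. -/
theorem isSimpleModule_transpose {R : Type v} [CommRing R] [IsArtinianRing R] [Algebra R A]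
    [Module.Finite R A] (hA : IsNakayama A) (h₀ : IsUniserialProjective A P₀)
    (h₁ : IsUniserialProjective A P₁) {d : P₁ →ₗ[A] P₀} (hd : LinearMap.range d = properSup A P₀)
    (hd0 : d ≠ 0) : IsSimpleModule Aᵐᵒᵖ (Transpose d) := by
  rw [isSimpleModule_iff_isCoatom]
  obtain ⟨p, s, hps⟩ := h₁.exists_retract
  refine ⟨fun h => notMem_range_dualMap h₀ h₁ hd hps (h ▸ Submodule.mem_top), fun N hN => ?_⟩
  obtain ⟨x, hxN, hx⟩ := SetLike.exists_of_lt hN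
  obtain ⟨φ, hφ⟩ := exists_comp_eq_id (R := R) hA h₀ h₁ hd hd0 hx
  rw [eq_top_iff]
  intro y _
  have h1 : y = MulOpposite.op (y (φ 1)) • x := by
    ext z
    change y z = x z * y (φ 1)
    rw [← smul_eq_mul, ← map_smul, ← map_smul, smul_eq_mul, mul_one]
    exact congrArg y (LinearMap.congr_fun hφ z).symm
  rw [h1]
  exact N.smul_mem _ hxN

/-- A functional θ not vanishing on the class of s gives p 1 ↦ s(p 1)·θ, which is nonzero because s
· s(p 1) = s. This identifies the top of P₁ with D Tr once the latter is known to be simple. -/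
theorem exists_ne_zero_artinDual_transpose {R : Type v} [CommRing R] [IsArtinianRing R]
    [Algebra R A] {J : Type v} [AddCommGroup J] [Module R J]
    {i : (R ⧸ Ring.jacobson R) →ₗ[R] J} (hi : IsInjectiveEnvelope i)
    (h₀ : IsUniserialProjective A P₀) (h₁ : IsUniserialProjective A P₁) {d : P₁ →ₗ[A] P₀}
    (hd : LinearMap.range d = properSup A P₀) :
    ∃ m : P₁ →ₗ[A] ArtinDual R (Transpose d) J, m ≠ 0 := by
  obtain ⟨p, s, hps⟩ := h₁.exists_retract
  have hs : (Submodule.Quotient.mk s : Transpose d) ∉ (⊥ : Submodule R (Transpose d)) := by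
    rw [Submodule.mem_bot, Submodule.Quotient.mk_eq_zero]
    exact notMem_range_dualMap h₀ h₁ hd hps
  obtain ⟨θ, -, hθ⟩ := hi.exists_apply_ne_zero hs
  refine ⟨LinearMap.toSpanSingleton A _ (ArtinDual.toHom.symm θ) ∘ₗ s, fun hm => hθ ?_⟩
  have h1 : ArtinDual.toHom (s (p 1) • (ArtinDual.toHom.symm θ : ArtinDual R (Transpose d) J))
      (Submodule.Quotient.mk s) = 0 := by
    have h2 : s (p 1) • (ArtinDual.toHom.symm θ : ArtinDual R (Transpose d) J) = 0 :=
      LinearMap.congr_fun hm (p 1)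
    rw [h2]
    rfl
  have h3 : MulOpposite.op (s (p 1)) • s = s := by
    ext y
    change s y * s (p 1) = s y
    rw [← smul_eq_mul, ← map_smul, ← map_smul, smul_eq_mul, mul_one]
    exact congrArg s (LinearMap.congr_fun hps y)
  rw [ArtinDual.smul_toHom, ← Submodule.Quotient.mk_smul, h3] at h1
  exact h1

end Transpose

namespace ResolutionQuiver

/-! ### The modified translate τ̃ is the successor permutation. -/

section Translate

variable {R : Type v} {A : Type u} [CommRing R] [IsArtinianRing R] [Ring A] [Algebra R A]
  [Module.Finite R A]

/-- If rad P(s) ≠ 0, it maps onto the simple σ s. Injectivity would extend this map to P(s), but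
maps from P(s) to a simple module kill rad P(s). -/
theorem IsSuccessor.properSup_eq_bot_of_injective (hA : IsNakayama A)
    {σ : Equiv.Perm (ResolutionQuiver R A)} (hσ : IsSuccessor σ) {s : ResolutionQuiver R A}
    (h : Module.Injective A (σ s).simple) : properSup A s.proj = ⊥ := by
  by_contra hs
  have hP := s.isUniserialProjective hA
  have := hP.finite
  have := hP.nontrivial
  have hQ := (σ s).isUniserialProjective hA
  have := hQ.finite
  have := hQ.nontrivial
  have := IsSimpleModule.nontrivial A (σ s).simple
  obtain ⟨d, hd⟩ := hσ s
  obtain ⟨q, hq⟩ := (σ s).exists_surjective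
  have hq0 := surjective_ne_zero hq
  have hker : LinearMap.ker d ≤ LinearMap.ker q := by
    rw [ker_eq_properSup hQ.uniserial hq0]
    refine le_properSup fun h => hs ?_
    rw [← hd, LinearMap.ker_eq_top.1 h, LinearMap.range_zero]
  obtain ⟨g, hg⟩ := (Module.Baer.of_injective h).extension_property
    ((LinearMap.ker d).liftQ d le_rfl)
    (LinearMap.ker_eq_bot.1 (Submodule.ker_liftQ_eq_bot _ _ _ le_rfl))
    ((LinearMap.ker d).liftQ q hker)
  have hgd : ∀ x, g (d x) = q x := fun x => LinearMap.congr_fun hg (Submodule.Quotient.mk x)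
  have hg0 : g ≠ 0 := by
    rintro rfl
    exact hq0 (LinearMap.ext fun x => (hgd x).symm)
  apply hq0
  ext x
  have h1 : d x ∈ LinearMap.ker g := by
    rw [ker_eq_properSup hP.uniserial hg0, ← hd]
    exact ⟨x, rfl⟩
  rw [← hgd]
  exact h1

/-- Baer's criterion with a maximal extension F. If its domain is proper, a minimal larger left
ideal adds the image of some P(t), which meets the domain in the image of rad P(t), a quotient of
P(σ t). F vanishes there: otherwise σ t = σ s, so t = s and rad P(t) = 0. Thus F extends by zero. -/
theorem IsSuccessor.injective_of_properSup_eq_bot (hA : IsNakayama A)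
    {σ : Equiv.Perm (ResolutionQuiver R A)} (hσ : IsSuccessor σ) {s : ResolutionQuiver R A}
    (h : properSup A s.proj = ⊥) : Module.Injective A (σ s).simple := by
  have : IsArtinianRing A := IsArtinianRing.of_finite R A
  have hnt := IsSimpleModule.nontrivial A (σ s).simple
  refine Module.Baer.injective fun I g => ?_
  let S : Set (Submodule A A) :=
    {D | ∃ F : A →ₗ.[A] (σ s).simple, F.domain = D ∧ (⟨I, g⟩ : A →ₗ.[A] (σ s).simple) ≤ F}
  obtain ⟨D, ⟨F, rfl, hF⟩, hmax⟩ := WellFounded.has_min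
    (wellFounded_gt : WellFounded ((· > ·) : Submodule A A → Submodule A A → Prop))
    S ⟨I, ⟨I, g⟩, rfl, le_rfl⟩
  by_cases htop : F.domain = ⊤
  · refine ⟨F.toFun ∘ₗ (LinearMap.id.codRestrict F.domain fun x => htop ▸ Submodule.mem_top),
      fun x hx => ?_⟩
    exact (hF.2 (x := ⟨x, hx⟩) (y := ⟨x, htop ▸ Submodule.mem_top⟩) rfl).symm
  exfalso
  obtain ⟨D, hD⟩ := exists_covBy_of_wellFoundedLT (α := Submodule A A) (a := F.domain)
    (by simpa [isMax_iff_eq_top] using htop)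
  have hsimple := (covBy_iff_quot_is_simple hD.le).1 hD
  obtain ⟨t, f, hf⟩ := exists_lift (R := R) (Submodule.mkQ_surjective (F.domain.comap D.subtype))
  have hP := t.isUniserialProjective hA
  have := hP.finite
  have := hP.nontrivial
  have := IsSimpleModule.nontrivial A (D ⧸ F.domain.comap D.subtype)
  have hker := ker_eq_properSup hP.uniserial (surjective_ne_zero hf)
  have hmem : ∀ x, ((f x : D) : A) ∈ F.domain ↔ x ∈ properSup A t.proj := by
    intro x
    rw [← hker, LinearMap.mem_ker, LinearMap.comp_apply, Submodule.mkQ_apply,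
      Submodule.Quotient.mk_eq_zero]
    rfl
  -- the restriction of `F` to the radical of `P(t)`
  obtain ⟨d, hd⟩ := hσ t
  let k : (σ t).proj →ₗ[A] F.domain := (D.subtype ∘ₗ f ∘ₗ d).codRestrict F.domain fun x =>
    (hmem (d x)).2 (hd ▸ ⟨x, rfl⟩)
  have hk : F.toFun ∘ₗ k = 0 := by
    by_contra hne
    obtain ⟨q, hq⟩ := (σ s).exists_surjective
    have h1 : σ t = σ s := eq_of_ne_zero hA hne (surjective_ne_zero hq)
    have h2 : t = s := σ.injective h1
    subst h2
    apply hne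
    rw [h, LinearMap.range_eq_bot] at hd
    ext x
    have h3 : k x = 0 := Subtype.ext (by
      change ((f (d x) : D) : A) = 0
      rw [hd]
      simp)
    rw [LinearMap.comp_apply, h3, map_zero, LinearMap.zero_apply]
  have hcompat : ∀ (x : F.domain)
      (y : (⟨LinearMap.range (D.subtype ∘ₗ f), 0⟩ : A →ₗ.[A] (σ s).simple).domain),
      (x : A) = y → F x = (⟨LinearMap.range (D.subtype ∘ₗ f), 0⟩ : A →ₗ.[A] (σ s).simple) y := by
    rintro ⟨x, hx⟩ ⟨y, z, rfl⟩ hxy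
    change x = ((f z : D) : A) at hxy
    subst hxy
    obtain ⟨w, rfl⟩ := hd.symm ▸ (hmem z).1 hx
    exact LinearMap.congr_fun hk w
  have hle := LinearPMap.left_le_sup F _ hcompat
  refine hmax _ ⟨F.sup _ hcompat, rfl, hF.trans hle⟩ ?_
  refine lt_of_le_of_ne hle.1 fun heq => ?_
  obtain ⟨y, hy⟩ := exists_ne (0 : D ⧸ F.domain.comap D.subtype)
  obtain ⟨x, rfl⟩ := hf y
  apply hy
  refine (Submodule.Quotient.mk_eq_zero _).2 ?_
  change ((f x : D) : A) ∈ F.domain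
  rw [heq]
  exact Submodule.mem_sup_right (show _ ∈ LinearMap.range (D.subtype ∘ₗ f) from ⟨x, rfl⟩)

/-- For a minimal projective presentation of a nonprojective simple module, the module `D Tr` is
the successor. -/
theorem IsSuccessor.nonempty_equiv_artinDual (hA : IsNakayama A)
    {σ : Equiv.Perm (ResolutionQuiver R A)} (hσ : IsSuccessor σ) {s : ResolutionQuiver R A}
    (hs : properSup A s.proj ≠ ⊥) {M : Type u} [AddCommGroup M] [Module A M] [IsSimpleModule A M]
    (e : M ≃ₗ[A] s.simple) {P₀ P₁ : Type u} [AddCommGroup P₀] [Module A P₀] [AddCommGroup P₁]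
    [Module A P₁] {d : P₁ →ₗ[A] P₀} {π : P₀ →ₗ[A] M} (hπ : IsMinimalPresentation d π)
    {J : Type v} [AddCommGroup J] [Module R J] {i : (R ⧸ Ring.jacobson R) →ₗ[R] J}
    (hi : IsInjectiveEnvelope i) :
    Nonempty (ArtinDual R (Transpose d) J ≃ₗ[A] (σ s).simple) := by
  obtain ⟨hπ₀, hdπ, hd⟩ := hπ
  have := IsSimpleModule.nontrivial A M
  have hP := s.isUniserialProjective hA
  have := hP.finite
  have := hP.nontrivial
  have h₀ := hπ₀.isUniserialProjective hA
  have := h₀.finite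
  have := h₀.nontrivial
  have hker := ker_eq_properSup h₀.uniserial (surjective_ne_zero hπ₀.surjective)
  obtain ⟨q, hq⟩ := s.exists_surjective
  obtain ⟨e₀⟩ := hP.nonempty_equiv h₀ (f := e.symm.toLinearMap ∘ₗ q) (g := π)
    (e.symm.surjective.comp hq) hπ₀.surjective
  have hrad : (properSup A s.proj).map e₀.toLinearMap = properSup A P₀ :=
    map_eq_of_surjective_properSup hP.uniserial (f := e₀.toLinearMap) e₀.surjective
  have hrange : LinearMap.range d = properSup A P₀ := by
    rw [← hker]
    ext x
    constructor
    · rintro ⟨y, rfl⟩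
      exact hdπ y
    · intro hx
      obtain ⟨y, hy⟩ := hd.surjective ⟨x, hx⟩
      exact ⟨y, congrArg Subtype.val hy⟩
  have hne : properSup A P₀ ≠ ⊥ := by
    rw [← hrad]
    intro h
    exact hs ((Submodule.map_eq_bot_iff (e := e₀)).1 h)
  have hd0 : d ≠ 0 := by
    rintro rfl
    exact hne (by rw [← hrange, LinearMap.range_zero])
  obtain ⟨d', hd'⟩ := hσ s
  have hU := (σ s).isUniserialProjective hA
  have := hU.projective
  have hmem : ∀ x, (e₀.toLinearMap ∘ₗ d') x ∈ LinearMap.ker π := by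
    intro x
    rw [hker, ← hrad]
    exact ⟨d' x, hd' ▸ ⟨x, rfl⟩, rfl⟩
  have hsurj : Function.Surjective ((e₀.toLinearMap ∘ₗ d').codRestrict _ hmem) := by
    rintro ⟨x, hx⟩
    rw [hker, ← hrad, ← hd'] at hx
    obtain ⟨_, ⟨z, rfl⟩, rfl⟩ := hx
    exact ⟨z, rfl⟩
  -- Both P₁ and P(σ s) map onto ker π; the lift h is onto by superfluity, hence an isomorphism.
  obtain ⟨h, hh⟩ := Module.projective_lifting_property _ ((e₀.toLinearMap ∘ₗ d').codRestrict _ hmem)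
    hd.surjective
  have hhs : Function.Surjective h := by
    rw [← LinearMap.range_eq_top]
    refine hd.superfluous _ (eq_top_iff.2 fun y _ => ?_)
    obtain ⟨x, hx⟩ := hsurj (d.codRestrict _ hdπ y)
    rw [← hh] at hx
    refine Submodule.mem_sup.2 ⟨h x, ⟨x, rfl⟩, y - h x, ?_, by abel⟩
    rw [LinearMap.mem_ker, map_sub, sub_eq_zero]
    exact hx.symm
  have hnt₁ : Nontrivial P₁ := by
    by_contra hnt
    rw [not_nontrivial_iff_subsingleton] at hnt
    exact hd0 (LinearMap.ext fun x => by rw [Subsingleton.elim x 0, map_zero, map_zero])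
  have := hd.projective
  let e₁ := LinearEquiv.ofBijective h
    ⟨IsUniserialProjective.injective_of_surjective hU.uniserial hhs, hhs⟩
  have h₁ : IsUniserialProjective A P₁ := hU.of_equiv e₁
  obtain ⟨m, hm⟩ := exists_ne_zero_artinDual_transpose hi h₀ h₁ hrange
  obtain ⟨p', s', hps'⟩ := h₁.exists_retract
  have : Module.Finite R (P₁ →ₗ[A] A) := finite_dual_of_retract hps'
  have hsimple : IsSimpleModule A (ArtinDual R (Transpose d) J) :=
    hi.isSimpleModule_dual (isSimpleModule_transpose (R := R) hA h₀ h₁ hrange hd0)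
  refine nonempty_equiv_of_surjective hA (f := m ∘ₗ e₁.toLinearMap) fun h0 => hm ?_
  ext y
  obtain ⟨x, rfl⟩ := e₁.surjective y
  exact LinearMap.congr_fun h0 x

theorem IsSuccessor.exists_isMinimalPresentation (hA : IsNakayama A)
    {σ : Equiv.Perm (ResolutionQuiver R A)} (hσ : IsSuccessor σ) {s : ResolutionQuiver R A}
    (hs : properSup A s.proj ≠ ⊥) {M : Type u} [AddCommGroup M] [Module A M] [IsSimpleModule A M]
    (e : M ≃ₗ[A] s.simple) :
    ∃ (d : (σ s).proj →ₗ[A] s.proj) (π : s.proj →ₗ[A] M), IsMinimalPresentation d π := by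
  have := IsSimpleModule.nontrivial A M
  have hP := s.isUniserialProjective hA
  have := hP.finite
  have := hP.nontrivial
  have hU := (σ s).isUniserialProjective hA
  obtain ⟨q, hq⟩ := s.exists_surjective
  obtain ⟨d, hd⟩ := hσ s
  have hπ : Function.Surjective (e.symm.toLinearMap ∘ₗ q) := e.symm.surjective.comp hq
  have hker := ker_eq_properSup hP.uniserial (surjective_ne_zero hπ)
  have hmem : ∀ x, d x ∈ LinearMap.ker (e.symm.toLinearMap ∘ₗ q) := fun x => by
    rw [hker, ← hd]
    exact ⟨x, rfl⟩
  refine ⟨d, e.symm.toLinearMap ∘ₗ q, ⟨hP.projective, hπ, fun N hN => ?_⟩, hmem,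
    hU.projective, ?_, fun N hN => ?_⟩
  · by_contra hne
    exact sup_ne_top hP.uniserial hne (hker ▸ hP.properSup_ne_top) hN
  · rintro ⟨x, hx⟩
    rw [hker, ← hd] at hx
    obtain ⟨y, rfl⟩ := hx
    exact ⟨y, rfl⟩
  · by_contra hne
    refine sup_ne_top hU.uniserial hne (fun h => hs ?_) hN
    rw [LinearMap.ker_codRestrict, LinearMap.ker_eq_top] at h
    rw [← hd, h, LinearMap.range_zero]

/-- For nonprojective M this is the computation of D Tr. For projective M, the simple injective
modules are the successors of simple projectives, and there is at most one simple projective. -/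
theorem IsSuccessor.isTauTilde_iff (hconn : IsConnectedRing A) (hA : IsNakayama A)
    {σ : Equiv.Perm (ResolutionQuiver R A)} (hσ : IsSuccessor σ) {s t : ResolutionQuiver R A}
    {M : Type u} [AddCommGroup M] [Module A M] [IsSimpleModule A M] (e : M ≃ₗ[A] s.simple) :
    IsTauTilde A R M t.simple ↔ t = σ s := by
  have hproj : Module.Projective A M ↔ properSup A s.proj = ⊥ := by
    rw [← projective_simple_iff hA]
    exact ⟨fun _ => Module.Projective.of_equiv e, fun _ => Module.Projective.of_equiv e.symm⟩
  unfold IsTauTilde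
  rw [hproj]
  by_cases hs : properSup A s.proj = ⊥
  · simp only [hs, not_true_eq_false, false_and, true_and, false_or]
    constructor
    · rintro ⟨-, ht⟩
      obtain ⟨t', rfl⟩ := σ.surjective t
      rw [hσ.eq_of_properSup_eq_bot hconn hA hs (hσ.properSup_eq_bot_of_injective hA ht)]
    · rintro rfl
      exact ⟨inferInstance, hσ.injective_of_properSup_eq_bot hA hs⟩
  · simp only [hs, not_false_eq_true, true_and, false_and, or_false]
    constructor
    · rintro ⟨P₀, P₁, d, π, J, i, hπ, hi, ⟨e'⟩⟩
      obtain ⟨e''⟩ := hσ.nonempty_equiv_artinDual hA hs e hπ hi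
      exact eq_of_equiv ⟨e'.trans e''⟩
    · rintro rfl
      obtain ⟨d, π, hπ⟩ := hσ.exists_isMinimalPresentation hA hs e
      obtain ⟨J, i, hi⟩ := exists_injectiveEnvelope R (R ⧸ Ring.jacobson R)
      obtain ⟨e''⟩ := hσ.nonempty_equiv_artinDual hA hs e hπ hi
      exact ⟨ModuleCat.of A s.proj, ModuleCat.of A (σ s).proj, d, π, J, i, hπ, hi, ⟨e''.symm⟩⟩

end Translate

end ResolutionQuiver

/-! ### Projective dimension and reduction to simple modules. -/

section ProjectiveDimension

open CategoryTheory

variable {A : Type u} [Ring A]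

/-- The projective dimension of a module is at most `d`. -/
abbrev ProjDimLE (A : Type u) [Ring A] (M : Type u) [AddCommGroup M] [Module A M] (d : ℕ) : Prop :=
  HasProjectiveDimensionLE (ModuleCat.of A M) d

theorem projDimLE_zero_iff {M : Type u} [AddCommGroup M] [Module A M] :
    ProjDimLE A M 0 ↔ Module.Projective A M := by
  rw [IsProjective.iff_projective, projective_iff_hasProjectiveDimensionLE_zero]

theorem projDimLE_congr {M N : Type u} [AddCommGroup M] [Module A M] [AddCommGroup N] [Module A N]
    (e : M ≃ₗ[A] N) {d : ℕ} (h : ProjDimLE A M d) : ProjDimLE A N d :=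
  hasProjectiveDimensionLT_of_iso e.toModuleIso (d + 1)

theorem ProjDimLE.mono {M : Type u} [AddCommGroup M] [Module A M] {d e : ℕ} (h : ProjDimLE A M d)
    (hde : d ≤ e) : ProjDimLE A M e :=
  hasProjectiveDimensionLT_of_ge _ (d + 1) (e + 1) (Nat.succ_le_succ hde)

theorem projDimLE_succ_iff {P M : Type u} [AddCommGroup P] [Module A P] [AddCommGroup M]
    [Module A M] (hP : Module.Projective A P) {g : P →ₗ[A] M} (hg : Function.Surjective g) {d : ℕ} :
    ProjDimLE A M (d + 1) ↔ ProjDimLE A (LinearMap.ker g) d :=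
  (LinearMap.shortExact_shortComplexKer hg).hasProjectiveDimensionLT_X₃_iff d
    ((IsProjective.iff_projective P).1 hP)

theorem projDimLE_of_submodule_quotient {M : Type u} [AddCommGroup M] [Module A M]
    (N : Submodule A M) {d : ℕ} (h : ProjDimLE A N d) (h' : ProjDimLE A (M ⧸ N) d) :
    ProjDimLE A M d := by
  have hN : LinearMap.ker N.mkQ = N := N.ker_mkQ
  exact (LinearMap.shortExact_shortComplexKer N.mkQ_surjective).hasProjectiveDimensionLT_X₂ (d + 1)
    (projDimLE_congr (LinearEquiv.ofEq _ _ hN.symm) h) h'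

theorem projDimLE_ker_mapRange {ι : Type u} (d : ℕ) {P M : ι → Type u} [∀ i, AddCommGroup (P i)]
    [∀ i, Module A (P i)] [∀ i, AddCommGroup (M i)] [∀ i, Module A (M i)] (p : ∀ i, P i →ₗ[A] M i)
    (h : ProjDimLE A (Π₀ i, LinearMap.ker (p i)) d) :
    ProjDimLE A (LinearMap.ker (DFinsupp.mapRange.linearMap p)) d := by
  let f : (Π₀ i, LinearMap.ker (p i)) →ₗ[A] Π₀ i, P i :=
    DFinsupp.mapRange.linearMap fun i => (LinearMap.ker (p i)).subtype
  have hf : Function.Injective f := by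
    intro x y hxy
    ext1 i
    exact Subtype.ext (DFunLike.congr_fun hxy i)
  have hfg : LinearMap.range f = LinearMap.ker (DFinsupp.mapRange.linearMap p) := by
    rw [DFinsupp.range_mapRangeLinearMap, DFinsupp.ker_mapRangeLinearMap]
    simp only [Submodule.range_subtype]
  exact projDimLE_congr ((LinearEquiv.ofInjective f hf).trans (LinearEquiv.ofEq _ _ hfg)) h

theorem projDimLE_succ_dfinsupp {ι : Type u} (d : ℕ) {P M : ι → Type u} [∀ i, AddCommGroup (P i)]
    [∀ i, Module A (P i)] [∀ i, Module.Projective A (P i)] [∀ i, AddCommGroup (M i)]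
    [∀ i, Module A (M i)] {p : ∀ i, P i →ₗ[A] M i} (hp : ∀ i, Function.Surjective (p i))
    (h : ProjDimLE A (Π₀ i, LinearMap.ker (p i)) d) : ProjDimLE A (Π₀ i, M i) (d + 1) := by
  have hg : Function.Surjective (DFinsupp.mapRange.linearMap p) := by
    rw [← LinearMap.range_eq_top, DFinsupp.range_mapRangeLinearMap, eq_top_iff]
    intro x _ i _
    exact hp i _
  exact (projDimLE_succ_iff inferInstance hg).2 (projDimLE_ker_mapRange d p h)

/-- Dimension shifting along free covers. Arbitrary direct sums are needed because global dimension
is tested on all modules, whose semisimple layers may be infinite. -/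
theorem projDimLE_dfinsupp {ι : Type u} (d : ℕ) (M : ι → Type u) [∀ i, AddCommGroup (M i)]
    [∀ i, Module A (M i)] (h : ∀ i, ProjDimLE A (M i) d) : ProjDimLE A (Π₀ i, M i) d := by
  induction d generalizing M with
  | zero =>
    have := fun i => projDimLE_zero_iff.1 (h i)
    exact projDimLE_zero_iff.2 inferInstance
  | succ d ih =>
    have hp : ∀ i, Function.Surjective (Finsupp.linearCombination A (id : M i → M i)) := fun i =>
      Finsupp.linearCombination_id_surjective A (M i)
    exact projDimLE_succ_dfinsupp d hp
      (ih _ fun i => (projDimLE_succ_iff inferInstance (hp i)).1 (h i))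

/-- Over an artinian ring the global dimension is the supremum of the projective dimensions of
the simple modules. -/
theorem projDimLE_of_simple [IsSemiprimaryRing A] {d : ℕ}
    (h : ∀ (X : Type u) [AddCommGroup X] [Module A X], IsSimpleModule A X → ProjDimLE A X d)
    (M : Type u) [AddCommGroup M] [Module A M] : ProjDimLE A M d := by
  refine IsSemiprimaryRing.induction ℤ A M (P := fun M _ _ _ => ProjDimLE A M d) ?_ ?_
  · intro M _ _ _ _ _ _
    obtain ⟨s, e, -, hs⟩ := IsSemisimpleModule.exists_linearEquiv_dfinsupp A M
    exact projDimLE_congr e.symm (projDimLE_dfinsupp d _ fun m => h m.1 (hs m))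
  · intro M _ _ _ _ N hN hQ
    exact projDimLE_of_submodule_quotient N hN hQ

end ProjectiveDimension

namespace ResolutionQuiver

/-! ### Syzygies of uniserial modules as moves of intervals. -/

section Syzygies

variable {R : Type v} {A : Type u} [CommRing R] [IsArtinianRing R] [Ring A] [Algebra R A]
  [Module.Finite R A]

/-- `M` is the quotient of length `y - x` of the projective cover of the `x`-th simple module,
counted from `s`. -/
def IsInterval (σ : Equiv.Perm (ResolutionQuiver R A)) (s : ResolutionQuiver R A) (M : Type u)
    [AddCommGroup M] [Module A M] (x y : ℕ) : Prop :=
  (x : ℕ∞) + Module.length A M = y ∧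
    ∃ g : ((σ ^ x) s).proj →ₗ[A] M, Function.Surjective g

/-- The lift of the map `γ` of the resolution quiver to the natural numbers. -/
noncomputable def lift (σ : Equiv.Perm (ResolutionQuiver R A)) (s : ResolutionQuiver R A) (x : ℕ) :
    ℕ :=
  x + ((σ ^ x) s).len

variable {σ : Equiv.Perm (ResolutionQuiver R A)} {s : ResolutionQuiver R A}

/-- The kernel is the submodule of P(σ^x s) at depth y - x, whose top, when it is nonzero, is σ^(y -
x) σ^x s = σ^y s; it ends where P(σ^x s) ends. -/
theorem IsSuccessor.isInterval_ker (hA : IsNakayama A) (hσ : IsSuccessor σ) {M : Type u}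
    [AddCommGroup M] [Module A M] {x y : ℕ} (hM : (x : ℕ∞) + Module.length A M = y)
    {g : ((σ ^ x) s).proj →ₗ[A] M} (hg : Function.Surjective g) :
    IsInterval σ s (LinearMap.ker g) y (lift σ s x) := by
  have : IsArtinianRing A := IsArtinianRing.of_finite R A
  have hP := ((σ ^ x) s).isUniserialProjective hA
  have := hP.finite
  have : Module.Finite A M := Module.Finite.of_surjective g hg
  have hadd := Module.length_eq_add_of_exact (LinearMap.ker g).subtype g
    (Submodule.injective_subtype _) hg (LinearMap.exact_subtype_ker_map g)
  rw [← coe_len hA] at hadd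
  obtain ⟨m, hm⟩ := ENat.ne_top_iff_exists.1 (length_ne_top (A := A) M)
  obtain ⟨k, hk⟩ := ENat.ne_top_iff_exists.1 (length_ne_top (A := A) (LinearMap.ker g))
  rw [← hm, ← hk] at hadd
  rw [← hm] at hM
  have hadd' : ((σ ^ x) s).len = k + m := by exact_mod_cast hadd
  have hM' : x + m = y := by exact_mod_cast hM
  subst hM'
  refine ⟨?_, ?_⟩
  · rw [← hk, lift, hadd']
    push_cast
    ring
  · obtain ⟨D, hD⟩ := hσ.exists_length_range hA ((σ ^ x) s) m (by omega)
    have hlen : Module.length A (LinearMap.range D) = Module.length A (LinearMap.ker g) := by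
      obtain ⟨k', hk'⟩ := ENat.ne_top_iff_exists.1 (length_ne_top (A := A) (LinearMap.range D))
      rw [← hk', hadd'] at hD
      rw [← hk', ← hk]
      have h2 : k' + m = k + m := by exact_mod_cast hD
      have h3 : k' = k := by omega
      rw [h3]
    rw [← eq_of_length_eq hP.uniserial hlen, add_comm x m, pow_add, Equiv.Perm.mul_apply]
    exact ⟨D.rangeRestrict, D.surjective_rangeRestrict⟩

theorem IsInterval.projective_iff (hA : IsNakayama A) {M : Type u} [AddCommGroup M] [Module A M]
    {x y : ℕ} (hM : IsInterval σ s M x y) :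
    Module.Projective A M ↔ x = y ∨ y = lift σ s x := by
  have : IsArtinianRing A := IsArtinianRing.of_finite R A
  obtain ⟨hlen, g, hg⟩ := hM
  have hP := ((σ ^ x) s).isUniserialProjective hA
  have := hP.finite
  have := hP.projective
  rcases subsingleton_or_nontrivial M with h | h
  · rw [Module.length_eq_zero, add_zero] at hlen
    exact ⟨fun _ => Or.inl (by exact_mod_cast hlen), fun _ => inferInstance⟩
  · constructor
    · intro hproj
      right
      have e := LinearEquiv.ofBijective g
        ⟨IsUniserialProjective.injective_of_surjective hP.uniserial hg, hg⟩
      rw [← e.length_eq, ← coe_len hA] at hlen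
      exact_mod_cast hlen.symm
    · intro hxy
      rcases hxy with rfl | rfl
      · exfalso
        have h1 : 0 < Module.length A M := Module.length_pos
        have : Module.Finite A M := Module.Finite.of_surjective g hg
        obtain ⟨m, hm⟩ := ENat.ne_top_iff_exists.1 (length_ne_top (A := A) M)
        rw [← hm] at h1 hlen
        have h2 : x + m = x := by exact_mod_cast hlen
        have h3 : 0 < m := by exact_mod_cast h1
        omega
      · have hadd := Module.length_eq_add_of_exact (LinearMap.ker g).subtype g
          (Submodule.injective_subtype _) hg (LinearMap.exact_subtype_ker_map g)
        have : Module.Finite A M := Module.Finite.of_surjective g hg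
        rw [← coe_len hA] at hadd
        obtain ⟨m, hm⟩ := ENat.ne_top_iff_exists.1 (length_ne_top (A := A) M)
        obtain ⟨k, hk⟩ := ENat.ne_top_iff_exists.1 (length_ne_top (A := A) (LinearMap.ker g))
        rw [← hm, ← hk] at hadd
        rw [← hm, lift] at hlen
        have h1 : ((σ ^ x) s).len = k + m := by exact_mod_cast hadd
        have h2 : x + m = x + ((σ ^ x) s).len := by exact_mod_cast hlen
        have h3 : k = 0 := by omega
        rw [h3, Nat.cast_zero, eq_comm, Module.length_eq_zero_iff,
          Submodule.subsingleton_iff_eq_bot] at hk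
        exact Module.Projective.of_equiv
          (LinearEquiv.ofBijective g ⟨LinearMap.ker_eq_bot.1 hk, hg⟩)

/-- Two syzygies apply the lift to both endpoints; after k rounds `IsInterval.projective_iff`
decides. -/
theorem IsSuccessor.projDimLE_two_mul_iff (hA : IsNakayama A) (hσ : IsSuccessor σ) (k : ℕ)
    {M : Type u} [AddCommGroup M] [Module A M] {x y : ℕ} (hM : IsInterval σ s M x y) :
    ProjDimLE A M (2 * k) ↔ (lift σ s)^[k] x = (lift σ s)^[k] y ∨
      (lift σ s)^[k] y = (lift σ s)^[k + 1] x := by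
  induction k generalizing M x y with
  | zero => exact projDimLE_zero_iff.trans (hM.projective_iff hA)
  | succ k ih =>
    obtain ⟨hlen, g, hg⟩ := hM
    obtain ⟨hlen', g', hg'⟩ := hσ.isInterval_ker hA hlen hg
    have h2 := hσ.isInterval_ker hA hlen' hg'
    rw [show 2 * (k + 1) = 2 * k + 1 + 1 by ring,
      projDimLE_succ_iff (((σ ^ x) s).isUniserialProjective hA).projective hg,
      projDimLE_succ_iff (((σ ^ y) s).isUniserialProjective hA).projective hg', ih h2]
    simp only [Function.iterate_succ_apply]

theorem isInterval_simple (s : ResolutionQuiver R A) (x : ℕ) :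
    IsInterval σ s ((σ ^ x) s).simple x (x + 1) := by
  refine ⟨?_, exists_surjective _⟩
  rw [Module.length_eq_one]
  norm_cast

/-- Finiteness of the global dimension in terms of the lift of the map `γ`. -/
theorem IsSuccessor.hasFiniteGlobalDimension_iff (hconn : IsConnectedRing A) (hA : IsNakayama A)
    (hσ : IsSuccessor σ) (s : ResolutionQuiver R A) :
    HasFiniteGlobalDimension A ↔ ∀ x, ∃ k, (lift σ s)^[k] x = (lift σ s)^[k] (x + 1) ∨
      (lift σ s)^[k] (x + 1) = (lift σ s)^[k + 1] x := by
  have : IsArtinianRing A := IsArtinianRing.of_finite R A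
  have : Finite (ResolutionQuiver R A) := finite
  constructor
  · rintro ⟨d, hd⟩ x
    -- A bound d also serves as the half-exponent, since d ≤ 2d.
    refine ⟨d, (hσ.projDimLE_two_mul_iff hA d (isInterval_simple s x)).1 ?_⟩
    exact (show ProjDimLE A ((σ ^ x) s).simple d from hd _).mono (by omega)
  · intro h
    have hd : ∀ t : ResolutionQuiver R A, ∃ d, ProjDimLE A t.simple d := by
      intro t
      obtain ⟨x, rfl⟩ := (hσ.sameCycle hconn hA s t).exists_nat_pow_eq
      obtain ⟨k, hk⟩ := h x
      exact ⟨2 * k, (hσ.projDimLE_two_mul_iff hA k (isInterval_simple s x)).2 hk⟩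
    choose d hd using hd
    obtain ⟨D, hD⟩ := (Set.finite_range d).bddAbove
    refine ⟨D, fun M => projDimLE_of_simple (fun X _ _ hX => ?_) M⟩
    obtain ⟨t, ⟨e⟩⟩ := exists_equiv (A := A) R X
    exact projDimLE_congr e.symm ((hd t).mono (hD ⟨t, rfl⟩))

end Syzygies

/-! ### The arrows of the resolution quiver. -/

section Arrows

variable {R : Type v} {A : Type u} [CommRing R] [IsArtinianRing R] [Ring A] [Algebra R A]
  [Module.Finite R A] {σ : Equiv.Perm (ResolutionQuiver R A)}

theorem socle_eq_of_isUniserial {M : Type*} [AddCommGroup M] [Module A M] (hM : IsUniserial A M)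
    {N : Submodule A M} (hN : IsSimpleModule A N) : socle A M = N := by
  refine le_antisymm (sSup_le fun N' hN' => ?_) (le_sSup hN)
  have h1 := isSimpleModule_iff_isAtom.1 hN
  have h2 := isSimpleModule_iff_isAtom.1 hN'
  rcases hM N N' with h | h
  · exact ((h2.le_iff_eq h1.1).1 h).ge
  · exact h

/-- The map `γ` of the resolution quiver. -/
noncomputable def gamma (σ : Equiv.Perm (ResolutionQuiver R A)) (s : ResolutionQuiver R A) :
    ResolutionQuiver R A :=
  (σ ^ s.len) s

theorem IsSuccessor.nonempty_hom_iff (hconn : IsConnectedRing A) (hA : IsNakayama A)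
    (hσ : IsSuccessor σ) (s t : ResolutionQuiver R A) : Nonempty (s ⟶ t) ↔ t = gamma σ s := by
  have : IsArtinianRing A := IsArtinianRing.of_finite R A
  have hP := s.isUniserialProjective hA
  have hpos := s.len_pos hA
  -- Depth len s - 1 leaves an image of length one, the socle, with class σ^(len s - 1) s; τ̃
  -- supplies the last σ.
  obtain ⟨D, hD⟩ := hσ.exists_length_range hA s (s.len - 1) (Nat.sub_le _ _)
  have hlen : Module.length A (LinearMap.range D) = 1 := by
    have := hP.finite
    obtain ⟨k, hk⟩ := ENat.ne_top_iff_exists.1 (length_ne_top (A := A) (LinearMap.range D))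
    rw [← hk] at hD ⊢
    have h1 : k + (s.len - 1) = s.len := by exact_mod_cast hD
    have h2 : k = 1 := by omega
    rw [h2, Nat.cast_one]
  have hsimple := Module.length_eq_one_iff.1 hlen
  have hsoc := socle_eq_of_isUniserial hP.uniserial hsimple
  have hnt := IsSimpleModule.nontrivial A (LinearMap.range D)
  obtain ⟨e⟩ := nonempty_equiv_of_surjective hA (surjective_ne_zero D.surjective_rangeRestrict)
  have hsocle : IsSimpleModule A (socle A s.proj) := hsoc.symm ▸ hsimple
  have key : IsTauTilde A R (socle A s.proj) t.simple ↔ t = σ ((σ ^ (s.len - 1)) s) :=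
    hσ.isTauTilde_iff hconn hA ((LinearEquiv.ofEq _ _ hsoc).trans e)
  rw [← Equiv.Perm.mul_apply, ← pow_succ', Nat.sub_add_cancel hpos] at key
  exact ⟨fun ⟨h⟩ => key.1 h.down, fun h => ⟨⟨key.2 h⟩⟩⟩

end Arrows

end ResolutionQuiver

/-! ### Components and cycles of the quiver of a self-map. -/

section FunctionalQuivers

variable {V : Type*} [Quiver V] {γ : V → V}

/-- A quiver with exactly one arrow `s ⟶ γ s` for each vertex is connected if and only if any two
`γ`-orbits meet. -/
theorem isConnectedQuiver_iff [Nonempty V] (hγ : ∀ s t : V, Nonempty (s ⟶ t) ↔ t = γ s) :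
    IsConnectedQuiver V ↔ ∀ s t, EventuallyMeet γ s t := by
  have harrow : ∀ s t : V, Nonempty (s ⟶ t) → EventuallyMeet γ s t :=
    fun s t h => ⟨1, 0, ((hγ s t).1 h).symm⟩
  constructor
  · rintro ⟨-, h⟩ s t
    obtain ⟨p⟩ := (Quiver.WeaklyConnectedComponent.eq s t).1 (Subsingleton.elim _ _)
    induction p with
    | nil => exact EventuallyMeet.refl γ s
    | cons _ e ih =>
      refine ih.trans ?_
      rcases e with e | e
      exacts [harrow _ _ ⟨e⟩, (harrow _ _ ⟨e⟩).symm]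
  · intro h
    have hmk : ∀ (k : ℕ) (s : V), (Quiver.WeaklyConnectedComponent.mk (γ^[k] s)) =
        Quiver.WeaklyConnectedComponent.mk s := by
      intro k s
      induction k with
      | zero => rfl
      | succ k ih =>
        rw [Function.iterate_succ_apply', ← ih]
        obtain ⟨e⟩ := (hγ (γ^[k] s) _).2 rfl
        exact ((Quiver.WeaklyConnectedComponent.eq _ _).2 ⟨Quiver.Hom.toPath (Sum.inl e)⟩).symm
    refine ⟨inferInstance, ⟨fun x y => ?_⟩⟩
    obtain ⟨s, rfl⟩ := Quotient.exists_rep x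
    obtain ⟨t, rfl⟩ := Quotient.exists_rep y
    obtain ⟨a, b, hab⟩ := h s t
    exact (hmk a s).symm.trans ((congrArg _ hab).trans (hmk b t))

theorem eq_map_iterate_of_isChain {V : Type*} {γ : V → V} {l : List V} {a : V}
    (h : (a :: l).IsChain fun s t => t = γ s) :
    a :: l = (List.range (l.length + 1)).map fun i => γ^[i] a := by
  induction l generalizing a with
  | nil => rfl
  | cons b l ih =>
    obtain ⟨rfl, hl⟩ := List.isChain_cons_cons.1 h
    rw [List.length_cons, List.range_succ_eq_map (n := l.length + 1), List.map_cons, List.map_map,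
      ih hl]
    rfl

/-- The chain condition lists successive iterates and closes up after the last one; distinctness
forces the length to be the minimal period. -/
theorem isQuiverCycle_iff (hγ : ∀ s t : V, Nonempty (s ⟶ t) ↔ t = γ s) {C : Cycle V} :
    IsQuiverCycle C ↔ ∃ s ∈ Function.periodicPts γ, C = Function.periodicOrbit γ s := by
  have hrel : (fun s t : V => Nonempty (s ⟶ t)) = fun s t => t = γ s := by
    ext s t
    exact hγ s t
  unfold IsQuiverCycle
  rw [hrel]
  constructor
  · rintro ⟨hnil, hnodup, hchain⟩
    induction C using Cycle.induction_on with
    | nil => exact absurd rfl hnil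
    | cons a l =>
      rw [Cycle.chain_coe_cons] at hchain
      rw [Cycle.nodup_coe_iff] at hnodup
      have h1 := eq_map_iterate_of_isChain hchain
      rw [List.length_append, List.length_singleton, List.range_succ, List.map_append,
        ← List.cons_append] at h1
      obtain ⟨h2, h3⟩ := List.append_inj' h1 rfl
      have hper : Function.IsPeriodicPt γ (l.length + 1) a := (List.singleton_inj.1 h3).symm
      have hs : a ∈ Function.periodicPts γ := ⟨_, Nat.succ_pos _, hper⟩
      have hmin : Function.minimalPeriod γ a = l.length + 1 := by
        refine le_antisymm (hper.minimalPeriod_le (Nat.succ_pos _)) (not_lt.1 fun hlt => ?_)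
        rw [h2, List.nodup_map_iff_inj_on List.nodup_range] at hnodup
        have h4 := hnodup _ (List.mem_range.2 hlt) 0 (by simp)
          (Function.iterate_minimalPeriod (f := γ) (x := a))
        exact (Function.minimalPeriod_pos_of_mem_periodicPts hs).ne' h4
      exact ⟨a, hs, by rw [Function.periodicOrbit, hmin, h2]⟩
  · rintro ⟨s, hs, rfl⟩
    refine ⟨fun h => Function.periodicOrbit_eq_nil_iff_not_periodic_pt.1 h hs,
      Function.nodup_periodicOrbit, (Function.periodicOrbit_chain' _ hs).2 fun k => ?_⟩
    exact Function.iterate_succ_apply' γ k s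

end FunctionalQuivers

namespace ResolutionQuiver

/-! ### Weights of cycles as sums over periodic orbits. -/

section Weight

variable {R : Type v} {A : Type u} [CommRing R] [IsArtinianRing R] [Ring A] [Algebra R A]
  [Module.Finite R A]

theorem cycleWeight_periodicOrbit (γ : ResolutionQuiver R A → ResolutionQuiver R A)
    (s : ResolutionQuiver R A) :
    cycleWeight (Function.periodicOrbit γ s) =
      ((∑ i ∈ Finset.range (Function.minimalPeriod γ s), (γ^[i] s).len : ℕ) : ℚ) /
        Nat.card (ResolutionQuiver R A) := by
  rw [cycleWeight, Function.periodicOrbit, Cycle.coe_toMultiset, Nat.cast_sum, Finset.sum_div,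
    ← Multiset.map_coe, Multiset.map_map]
  rfl

theorem hasWeight_one_iff [Finite (ResolutionQuiver R A)] [Nonempty (ResolutionQuiver R A)]
    {γ : ResolutionQuiver R A → ResolutionQuiver R A}
    (hγ : ∀ s t : ResolutionQuiver R A, Nonempty (s ⟶ t) ↔ t = γ s) :
    HasWeight R A 1 ↔ ∀ s ∈ Function.periodicPts γ,
      ∑ i ∈ Finset.range (Function.minimalPeriod γ s), (γ^[i] s).len =
        Nat.card (ResolutionQuiver R A) := by
  have hcard : (Nat.card (ResolutionQuiver R A) : ℚ) ≠ 0 := Nat.cast_ne_zero.2 Nat.card_pos.ne'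
  have hone : ∀ s, cycleWeight (Function.periodicOrbit γ s) = 1 ↔
      ∑ i ∈ Finset.range (Function.minimalPeriod γ s), (γ^[i] s).len =
        Nat.card (ResolutionQuiver R A) := by
    intro s
    rw [cycleWeight_periodicOrbit, div_eq_one_iff_eq hcard, Nat.cast_inj]
  constructor
  · rintro ⟨-, h⟩ s hs
    exact (hone s).1 (h _ ((isQuiverCycle_iff hγ).2 ⟨s, hs, rfl⟩))
  · intro h
    obtain ⟨s, hs⟩ := nonempty_periodicPts γ
    refine ⟨⟨_, (isQuiverCycle_iff hγ).2 ⟨s, hs, rfl⟩⟩, fun C hC => ?_⟩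
    obtain ⟨t, ht, rfl⟩ := (isQuiverCycle_iff hγ).1 hC
    exact (hone t).2 (h t ht)

end Weight

/-! ### Periodicity and monotonicity of the lift. -/

section Lift

variable {R : Type v} {A : Type u} [CommRing R] [IsArtinianRing R] [Ring A] [Algebra R A]
  [Module.Finite R A]

theorem IsSuccessor.pow_apply_eq_pow_apply_iff (hconn : IsConnectedRing A) (hA : IsNakayama A)
    {σ : Equiv.Perm (ResolutionQuiver R A)} (hσ : IsSuccessor σ) (s : ResolutionQuiver R A)
    (x y : ℕ) :
    (σ ^ x) s = (σ ^ y) s ↔ x ≡ y [MOD Nat.card (ResolutionQuiver R A)] := by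
  have : IsArtinianRing A := IsArtinianRing.of_finite R A
  have := finite (R := R) (A := A)
  have := Fintype.ofFinite (ResolutionQuiver R A)
  have hcyc : σ.IsCycleOn (Finset.univ : Finset (ResolutionQuiver R A)) := by
    rw [Finset.coe_univ]
    exact ⟨Set.bijOn_univ.2 σ.bijective, fun a _ b _ => hσ.sameCycle hconn hA a b⟩
  rw [hcyc.pow_apply_eq_pow_apply (Finset.mem_univ s), Nat.card_eq_fintype_card, Finset.card_univ]

theorem IsSuccessor.monotone_lift (hA : IsNakayama A) {σ : Equiv.Perm (ResolutionQuiver R A)}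
    (hσ : IsSuccessor σ) (s : ResolutionQuiver R A) : Monotone (lift σ s) := by
  refine monotone_nat_of_le_succ fun x => ?_
  have h := hσ.len_le hA ((σ ^ x) s)
  rw [← Equiv.Perm.mul_apply, ← pow_succ'] at h
  simp only [lift]
  omega

end Lift

theorem nonempty {R : Type v} {A : Type u} [CommRing R] [Ring A] [Algebra R A]
    (hconn : IsConnectedRing A) :
    Nonempty (ResolutionQuiver R A) := by
  have := hconn.1
  obtain ⟨m, hm⟩ := Ideal.exists_maximal A
  have : IsSimpleModule A (A ⧸ m) := isSimpleModule_iff_isCoatom.2 hm.out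
  exact ⟨(exists_equiv R (A ⧸ m)).choose⟩

end ResolutionQuiver

end NakayamaAlgebra

open NakayamaAlgebra ResolutionQuiver in
theorem proposition1p1 (R : Type v) (A : Type u) [CommRing R] [IsArtinianRing R] [Ring A]
    [Algebra R A] [Module.Finite R A] (hconn : NakayamaAlgebra.IsConnectedRing A)
    (hnak : NakayamaAlgebra.IsNakayama A) :
    NakayamaAlgebra.HasFiniteGlobalDimension A ↔
      NakayamaAlgebra.IsConnectedQuiver (NakayamaAlgebra.ResolutionQuiver R A) ∧
        NakayamaAlgebra.HasWeight R A 1 := by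
  have : IsArtinianRing A := IsArtinianRing.of_finite R A
  have := ResolutionQuiver.finite (R := R) (A := A)
  have := ResolutionQuiver.nonempty (R := R) hconn
  obtain ⟨s⟩ := this
  have : Nonempty (ResolutionQuiver R A) := ⟨s⟩
  obtain ⟨σ, hσ⟩ := ResolutionQuiver.exists_isSuccessor (R := R) hnak
  have hγ := hσ.nonempty_hom_iff hconn hnak
  rw [hσ.hasFiniteGlobalDimension_iff hconn hnak s, isConnectedQuiver_iff hγ,
    hasWeight_one_iff hγ]
  -- With c the length of the projective cover, the last goal says that `lift` lifts `gamma`: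
  -- σ^(len) σ^x s = σ^(x + len) s.
  refine forall_iterate_meet_iff (v := fun x => (σ ^ x) s) Nat.card_pos
    (fun t => (hσ.sameCycle hconn hnak s t).exists_nat_pow_eq)
    (hσ.pow_apply_eq_pow_apply_iff hconn hnak s) (fun _ => rfl) (fun x => ?_)
    (fun x => Nat.lt_add_of_pos_right (len_pos hnak _)) (hσ.monotone_lift hnak s)
  simp only [gamma, lift]
  rw [← Equiv.Perm.mul_apply, ← pow_add, add_comm]
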